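/- Let $M,m,l,J,N,\kappa,g,G,a,\alpha>0$ and $c_0,\varrho\in\mathbb R$, and put $L=ml$, $I=J+ml^2$, $c=c_0+\kappa l$. Assume $MI>L^2$, $\varrho L>I$ and $\kappa\varrho>c$. Consider the cart–pendulum $$M\ddot r+L\ddot\beta\cos\beta+N\dot r-L\dot\beta^2\sin\beta=Gu,\qquad L\cos\beta\,\ddot r+I\ddot\beta+c\dot\beta+\kappa\dot r\cos\beta-Lg\sin\beta=0,\qquad |\beta|<\pi/2 .$$ Put $\Omega=-\ln|\tan(\frac\pi4-\frac\beta2)|$, so that $\beta=2(\frac\pi4-\arctan e^{-\Omega})$, $s=r+\varrho\,\Omega$, $\psi=\psi(\beta)=MI-L^2\cos^2\beta$, $\gamma=\psi(\beta)(\dot s+\alpha s)$, $A=|G(I-\varrho L)|$, $d_1=\frac{\kappa\varrho-c}{\varrho L-I}$, $d_2=\frac{Lg}{\varrho L-I}$, $d_3=\frac{I}{\varrho L-I}$. For values $v,w$ used in place of $\dot r,\dot\beta$ put $\sigma=v+\varrho w/\cos\beta$ (the value used in place of $\dot s$) and $U(s,\beta,v,w)=\sum_{i=1}^{11}\lambda_iu_i$,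 where $u_1=v$, $u_2=v\cos^2\beta$, $u_3=w^2\sin\beta$, $u_4=w\cos\beta$, $u_5=\sin2\beta$, $u_6=w/\cos\beta$, $u_7=\tan\beta$, $u_8=a\sigma+\varrho w^2\sin\beta/\cos^2\beta$, $u_9=(w\sin2\beta-a\cos^2\beta)\sigma-\varrho w^2\sin\beta$, $u_{10}=\sigma+as$, $u_{11}=(\sigma+as)\cos^2\beta-sw\sin2\beta$, and $$\lambda_1=\tfrac{\varrho NL-IN-\varrho M\kappa}{A},\ \lambda_2=\tfrac{L\kappa}{A},\ \lambda_3=-\tfrac LG,\ \lambda_4=\tfrac{Lc}{A},\ \lambda_5=-\tfrac{L^2g}{2A},\ \lambda_6=-\tfrac{\varrho Mc}{A},\ \lambda_7=\tfrac{\varrho LMg}{A},\ \lambda_8=\tfrac{MI}{A},\ \lambda_9=\tfrac{L^2}{A},\ \lambda_{10}=\tfrac{MI\alpha}{A},\ \lambda_{11}=-\tfrac{\alpha L^2}{A}.$$ (With exact velocities, $u=U(s,\beta,\dot r,\dot\beta)$, the closed loop satisfies $\dot\gamma=-a\gamma$.) The velocities are not measured but replaced by the outputs of the filters $\mu\dot{\hat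 z}_1=\dot r-\hat z_1$, $\mu\dot{\hat z}_2=\dot\beta-\hat z_2$, i.e. $u=\hat u:=U(s,\beta,\hat z_1,\hat z_2)$. With $z_1=\hat z_1-\dot r$, $z_2=\hat z_2-\dot\beta$, $x=(s,\gamma,\Omega,\dot\Omega)\in\mathbb R^4$, $z=(z_1,z_2)\in\mathbb R^2$, the closed loop is the system $$\dot s=\frac{\gamma}{\psi}-\alpha s,\qquad \dot\gamma=-a\gamma-A\bigl(\hat u-U(s,\beta,\dot r,\dot\beta)\bigr),\qquad \frac{d\Omega}{dt}=\dot\Omega,$$ $$\ddot\Omega=-d_1\dot\Omega-d_2\tan\beta-d_3\dot\Omega^2\sin\beta+\frac{L\ddot s+\kappa\dot s}{\varrho L-I},\qquad \mu\dot z_1=-z_1-\mu\ddot r,\qquad \mu\dot z_2=-z_2-\mu\ddot\beta,\tag{S$_\mu$}$$ in which $\dot r=\dot s-\varrho\dot\Omega$, $\dot\beta=\dot\Omega\cos\beta$, $\ddot s=(\dot\gamma\psi-\gamma\dot\psi)/\psi^2-\alpha\dot s$, $\dot\psi=L^2\dot\beta\sin2\beta$, $\ddot r=\ddot s-\varrho\ddot\Omega$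 and $\ddot\beta=\ddot\Omega\cos\beta-\dot\Omega^2\sin\beta\cos\beta$ are expressed through $(x,z)$. Write the first four equations as $\dot x=f(x,z)$. Call $V:\mathbb R^4\to\mathbb R$ a Lyapunov function of the unperturbed system $\dot x=f(x,0)$ if $V$ is $C^1$, $V(0)=0$, $V(x)>0$ for $x\ne0$, $V(x)\to\infty$ as $|x|\to\infty$, and $\nabla V(x)\cdot f(x,0)\le-|x|^2$ for all $x$. Put $W(z)=\frac12|z|^2$ and $W_\rho(x,z)=V(x)+\rho W(z)$. A set $D$ is an attraction domain of the equilibrium $0$ of an autonomous system if $0$ is a Lyapunov stable equilibrium, $D$ is a neighbourhood of $0$, from each point of $D$ there starts a solution on $[0,\infty)$, and every such solution stays in $D$ and tends to $0$ as $t\to\infty$. **Theorem.** The unperturbed system has a Lyapunov function. For every Lyapunov function $V$ of it and every $\rho>0$ there are $\mu_0>0$ and a function $\bar\mu_1\mapsto C(\bar\mu_1)$ with $C(\bar\mu_1)>0$ for $0<\bar\mu_1\le\mu_0$ such that, for all $0<\bar\mu_1\le\mu_0$ and all $0<\mu\le\bar\mu_1$, the set $\{(x,z):W_\rho(x,z)\le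 C(\bar\mu_1)\}$ is an attraction domain of the equilibrium $x=0,\ z=0$ of (S$_\mu$). Moreover $C(\bar\mu_1)\to\infty$ as $\bar\mu_1\to0^+$; in particular every compact subset of the phase space $\mathbb R^4\times\mathbb R^2$ lies in $\{W_\rho\le C(\bar\mu_1)\}$ for all sufficiently small $\bar\mu_1>0$. -/

import Mathlib

open Set Filter Topology

noncomputable section

namespace CartPendulum

/-- Physical constants of the inverted pendulum on a cart, and the design constants `ϱ, a, α`
of the regulator. `M` is the inertia coefficient of `r''` in the cart equation. -/
structure Params where
  M : ℝ
  m : ℝ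
  l : ℝ
  J : ℝ
  N : ℝ
  κ : ℝ
  c₀ : ℝ
  g : ℝ
  G : ℝ
  ϱ : ℝ
  a : ℝ
  α : ℝ

namespace Params

variable (P : Params)

/-- `L = m l`. -/
def L : ℝ := P.m * P.l

/-- `I = J + m l ^ 2`. -/
def I : ℝ := P.J + P.m * P.l ^ 2

/-- `c = c₀ + κ l`. -/
def c : ℝ := P.c₀ + P.κ * P.l

/-- The standing assumptions on the constants. -/
structure Admissible : Prop where
  M_pos : 0 < P.M
  m_pos : 0 < P.m
  l_pos : 0 < P.l
  J_pos : 0 < P.J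
  N_pos : 0 < P.N
  κ_pos : 0 < P.κ
  g_pos : 0 < P.g
  G_pos : 0 < P.G
  a_pos : 0 < P.a
  α_pos : 0 < P.α
  /-- The mass matrix of the mechanical system is positive definite at every angle. -/
  inertia : P.L ^ 2 < P.M * P.I
  /-- Equivalent to `d₂ > 0`. -/
  rho_L : P.I < P.ϱ * P.L
  /-- Equivalent (given `rho_L`) to `d₁ > 0`. -/
  rho_κ : P.c < P.κ * P.ϱ

/-- `A = |G (I - ϱ L)|`. -/
def A : ℝ := |P.G * (P.I - P.ϱ * P.L)|

def d₁ : ℝ := (P.κ * P.ϱ - P.c) / (P.ϱ * P.L - P.I)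

def d₂ : ℝ := P.L * P.g / (P.ϱ * P.L - P.I)

def d₃ : ℝ := P.I / (P.ϱ * P.L - P.I)

/-- `ψ(β) = M I - L² cos² β`. -/
def psi (β : ℝ) : ℝ := P.M * P.I - P.L ^ 2 * Real.cos β ^ 2

/-- The coefficients `λ₁, …, λ₁₁` of the control `∑ λᵢ uᵢ`. -/
def gain : Fin 11 → ℝ :=
  ![(P.ϱ * P.N * P.L - P.I * P.N - P.ϱ * P.M * P.κ) / P.A,
    P.L * P.κ / P.A,
    -(P.L / P.G),
    P.L * P.c / P.A,
    -(P.L ^ 2 * P.g / (2 * P.A)),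
    -(P.ϱ * P.M * P.c / P.A),
    P.ϱ * P.L * P.M * P.g / P.A,
    P.M * P.I / P.A,
    P.L ^ 2 / P.A,
    P.M * P.I * P.α / P.A,
    -(P.α * P.L ^ 2 / P.A)]

/-- The functions `u₁, …, u₁₁`, evaluated at the position `s`, the angle `β`, and the values `v`,
`w` which the regulator uses for `r'` and `β'`. The value used for `s'` is then
`v + ϱ w / cos β`. -/
def signal (s β v w : ℝ) : Fin 11 → ℝ :=
  let σ := v + P.ϱ * w / Real.cos β
  ![v,
    v * Real.cos β ^ 2,
    w ^ 2 * Real.sin β,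
    w * Real.cos β,
    Real.sin (2 * β),
    w / Real.cos β,
    Real.tan β,
    P.a * σ + P.ϱ * w ^ 2 * Real.sin β / Real.cos β ^ 2,
    (w * Real.sin (2 * β) - P.a * Real.cos β ^ 2) * σ - P.ϱ * w ^ 2 * Real.sin β,
    σ + P.a * s,
    (σ + P.a * s) * Real.cos β ^ 2 - s * w * Real.sin (2 * β)]

/-- The control `u = ∑ λᵢ uᵢ`. -/
def control (s β v w : ℝ) : ℝ := ∑ i, P.gain i * P.signal s β v w i

end Params

/-- The angle `β` as a function of `Ω = - ln |tan (π/4 - β/2)|`. -/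
def angle (Ω : ℝ) : ℝ := 2 * (Real.pi / 4 - Real.arctan (Real.exp (-Ω)))

/-- Slow state `x = (s, γ, Ω, Ω')`. -/
abbrev X := EuclideanSpace ℝ (Fin 4)

/-- Fast state `z = (z₁, z₂)`, the errors of the velocity filters. -/
abbrev Z := EuclideanSpace ℝ (Fin 2)

namespace Params

variable (P : Params)

/-- `s' = γ / ψ(β) - α s`. -/
def sDot (x : X) : ℝ := x 1 / P.psi (angle (x 2)) - P.α * x 0

/-- `r' = s' - ϱ Ω'`. -/
def rDot (x : X) : ℝ := P.sDot x - P.ϱ * x 3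

/-- `β' = Ω' cos β`. -/
def betaDot (x : X) : ℝ := x 3 * Real.cos (angle (x 2))

/-- `dψ/dt = L² β' sin 2β`. -/
def psiDot (x : X) : ℝ := P.L ^ 2 * betaDot x * Real.sin (2 * angle (x 2))

/-- The control in which `r'`, `β'` are replaced by the filter outputs
`ẑ₁ = r' + z₁`, `ẑ₂ = β' + z₂`. -/
def filteredControl (x : X) (z : Z) : ℝ :=
  P.control (x 0) (angle (x 2)) (P.rDot x + z 0) (betaDot x + z 1)

/-- The same control with exact velocities. -/
def exactControl (x : X) : ℝ :=
  P.control (x 0) (angle (x 2)) (P.rDot x) (betaDot x)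

/-- `γ' = - a γ - A ∑ λᵢ (ûᵢ - uᵢ)`. -/
def gammaDot (x : X) (z : Z) : ℝ :=
  -P.a * x 1 - P.A * (P.filteredControl x z - P.exactControl x)

/-- `s'' = (γ' ψ - γ ψ') / ψ² - α s'`. -/
def sDDot (x : X) (z : Z) : ℝ :=
  (P.gammaDot x z * P.psi (angle (x 2)) - x 1 * P.psiDot x) / P.psi (angle (x 2)) ^ 2
    - P.α * P.sDot x

/-- `Ω'' = - d₁ Ω' - d₂ tan β - d₃ Ω'² sin β + (L s'' + κ s') / (ϱ L - I)`. -/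
def omegaDDot (x : X) (z : Z) : ℝ :=
  -P.d₁ * x 3 - P.d₂ * Real.tan (angle (x 2)) - P.d₃ * x 3 ^ 2 * Real.sin (angle (x 2))
    + (P.L * P.sDDot x z + P.κ * P.sDot x) / (P.ϱ * P.L - P.I)

/-- `f_r = r'' = s'' - ϱ Ω''`. -/
def rDDot (x : X) (z : Z) : ℝ := P.sDDot x z - P.ϱ * P.omegaDDot x z

/-- `f_β = β'' = Ω'' cos β - Ω'² sin β cos β`. -/
def betaDDot (x : X) (z : Z) : ℝ :=
  P.omegaDDot x z * Real.cos (angle (x 2))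
    - x 3 ^ 2 * Real.sin (angle (x 2)) * Real.cos (angle (x 2))

/-- Right-hand side of the slow subsystem `x' = f(x, z)`. -/
def slowField (x : X) (z : Z) : X :=
  !₂[P.sDot x, P.gammaDot x z, x 3, P.omegaDDot x z]

/-- Right-hand side of the singularly perturbed system
`x' = f(x, z)`, `μ z₁' = - z₁ - μ f_r`, `μ z₂' = - z₂ - μ f_β`. -/
def field (μ : ℝ) (y : X × Z) : X × Z :=
  (P.slowField y.1 y.2,
    !₂[(-y.2 0 - μ * P.rDDot y.1 y.2) / μ, (-y.2 1 - μ * P.betaDDot y.1 y.2) / μ])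

/-- `V` is a Lyapunov function of the unperturbed system `x' = f(x, 0)`: it is continuously
differentiable, positive definite, radially unbounded, and its derivative along the system is at
most `-|x|²`. -/
structure IsLyapunov (V : X → ℝ) : Prop where
  contDiff : ContDiff ℝ 1 V
  zero : V 0 = 0
  pos : ∀ x, x ≠ 0 → 0 < V x
  proper : Tendsto V (cocompact X) atTop
  decay : ∀ x, fderiv ℝ V x (P.slowField x 0) ≤ -‖x‖ ^ 2

end Params

/-- `W(z) = ⟨z, B z⟩` with `B = E / 2`, the solution of `Γᵀ B + B Γ = E` for `Γ = E`. -/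
def fastLyapunov (z : Z) : ℝ := ‖z‖ ^ 2 / 2

/-- `W_ρ(x, z) = V(x) + ρ W(z)`. -/
def composite (V : X → ℝ) (ρ : ℝ) (y : X × Z) : ℝ := V y.1 + ρ * fastLyapunov y.2

section ODE

variable {E : Type*} [NormedAddCommGroup E] [NormedSpace ℝ E]

/-- `y` solves `y' = F(y)` on `[0, ∞)`. -/
def IsForwardSolution (F : E → E) (y : ℝ → E) : Prop :=
  ∀ t, 0 ≤ t → HasDerivWithinAt y (F (y t)) (Ici 0) t

/-- `D` is an attraction domain of the equilibrium `0` of `y' = F(y)`: `0` is a Lyapunov stable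
equilibrium, `D` is a neighbourhood of it, and from every point of `D` there starts a
solution on `[0, ∞)`, and every such solution stays in `D` and tends to `0`. -/
structure IsAttractionDomain (F : E → E) (D : Set E) : Prop where
  equilibrium : F 0 = 0
  nhds : D ∈ 𝓝 (0 : E)
  stable : ∀ U ∈ 𝓝 (0 : E), ∃ U' ∈ 𝓝 (0 : E), ∀ y, IsForwardSolution F y → y 0 ∈ U' →
    ∀ t, 0 ≤ t → y t ∈ U
  exists_solution : ∀ y₀ ∈ D, ∃ y, IsForwardSolution F y ∧ y 0 = y₀
  invariant : ∀ y, IsForwardSolution F y → y 0 ∈ D → ∀ t, 0 ≤ t → y t ∈ D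
  attracts : ∀ y, IsForwardSolution F y → y 0 ∈ D → Tendsto y atTop (𝓝 0)

end ODE

/-! The accelerations in the system above are those of the mechanical system
`M r'' + L β'' cos β + N r' - L β'² sin β = G u`,
`L cos β r'' + I β'' + c β' + κ r' cos β - L g sin β = 0`
under the filtered control `u`. -/

theorem angle_mem (Ω : ℝ) : angle Ω ∈ Ioo (-(Real.pi / 2)) (Real.pi / 2) := by
  have h1 := Real.arctan_pos.2 (Real.exp_pos (-Ω))
  have h2 := Real.arctan_lt_pi_div_two (Real.exp (-Ω))
  constructor <;> unfold angle <;> linarith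

theorem plant_equations (P : Params) (hP : P.Admissible) (x : X) (z : Z) :
    P.M * P.rDDot x z + P.L * P.betaDDot x z * Real.cos (angle (x 2)) + P.N * P.rDot x
        - P.L * Params.betaDot x ^ 2 * Real.sin (angle (x 2)) = P.G * P.filteredControl x z ∧
    P.L * Real.cos (angle (x 2)) * P.rDDot x z + P.I * P.betaDDot x z + P.c * Params.betaDot x
        + P.κ * P.rDot x * Real.cos (angle (x 2)) - P.L * P.g * Real.sin (angle (x 2)) = 0 := by
  have hc : Real.cos (angle (x 2)) ≠ 0 := (Real.cos_pos_of_mem_Ioo (angle_mem _)).ne'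
  have hG : P.G ≠ 0 := hP.G_pos.ne'
  have hd0 : 0 < P.ϱ * P.L - P.I := by linarith [hP.rho_L]
  have hd : P.ϱ * P.L - P.I ≠ 0 := hd0.ne'
  have hA : P.A = P.G * (P.ϱ * P.L - P.I) := by
    unfold Params.A
    rw [abs_of_neg]
    · ring
    · nlinarith [mul_pos hP.G_pos hd0]
  have hA0 : P.A ≠ 0 := by rw [hA]; exact mul_ne_zero hG hd
  have hψ : P.psi (angle (x 2)) ≠ 0 := by
    unfold Params.psi
    have h1 := Real.cos_sq_le_one (angle (x 2))
    have h2 := hP.inertia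
    nlinarith [sq_nonneg P.L]
  have hex : P.A * P.exactControl x = (P.ϱ * P.L - P.I) * P.N * P.rDot x
      - (P.ϱ * P.L - P.I) * P.L * Params.betaDot x ^ 2 * Real.sin (angle (x 2))
      + (P.ϱ * P.M / Real.cos (angle (x 2)) - P.L * Real.cos (angle (x 2)))
        * (P.L * P.g * Real.sin (angle (x 2)) - P.c * Params.betaDot x
            - P.κ * P.rDot x * Real.cos (angle (x 2)))
      + P.ϱ * P.psi (angle (x 2)) * x 3 ^ 2 * Real.sin (angle (x 2))
      + P.psiDot x * (P.sDot x + P.α * x 0)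
      + P.psi (angle (x 2)) * (P.α * P.sDot x + P.a * P.sDot x + P.a * P.α * x 0) := by
    have hs : P.rDot x + P.ϱ * Params.betaDot x / Real.cos (angle (x 2)) = P.sDot x := by
      unfold Params.rDot Params.betaDot
      field_simp
      ring
    have hG3 : P.L / P.G = (P.ϱ * P.L - P.I) * P.L / P.A := by
      rw [hA, mul_comm P.G, mul_div_mul_left _ _ hd]
    unfold Params.exactControl Params.control Params.gain Params.signal
    simp only [hs, hG3, Fin.sum_univ_succ, Finset.univ_eq_empty, Finset.sum_empty,
      Matrix.cons_val_zero, Matrix.cons_val_succ, Real.sin_two_mul, Real.tan_eq_sin_div_cos,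
      Params.psiDot, Params.psi]
    have hb : Params.betaDot x = x 3 * Real.cos (angle (x 2)) := rfl
    rw [hb]
    generalize P.sDot x = sd
    generalize P.rDot x = rd
    field_simp
    ring
  have hγ : x 1 = P.psi (angle (x 2)) * (P.sDot x + P.α * x 0) := by
    unfold Params.sDot; field_simp; ring
  have hss : P.psi (angle (x 2)) * P.sDDot x z = P.gammaDot x z
      - P.psiDot x * (P.sDot x + P.α * x 0) - P.α * P.psi (angle (x 2)) * P.sDot x := by
    unfold Params.sDDot
    rw [hγ]; field_simp
  have hO : (P.ϱ * P.L - P.I) * P.omegaDDot x z = P.L * P.sDDot x z + P.κ * P.sDot x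
      - (P.κ * P.ϱ - P.c) * x 3 - P.L * P.g * Real.tan (angle (x 2))
      - P.I * x 3 ^ 2 * Real.sin (angle (x 2)) := by
    unfold Params.omegaDDot Params.d₁ Params.d₂ Params.d₃
    field_simp
    ring
  have hgd : P.gammaDot x z = -P.a * x 1 - P.A * P.filteredControl x z
      + P.A * P.exactControl x := by
    unfold Params.gammaDot; ring
  rw [hex] at hgd
  rw [Real.tan_eq_sin_div_cos] at hO
  rw [hA] at hgd
  rw [hγ] at hgd
  have hb : Params.betaDot x = x 3 * Real.cos (angle (x 2)) := rfl
  have hr : P.rDot x = P.sDot x - P.ϱ * x 3 := rfl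
  have hrr : P.rDDot x z = P.sDDot x z - P.ϱ * P.omegaDDot x z := rfl
  have hbb : P.betaDDot x z = P.omegaDDot x z * Real.cos (angle (x 2))
    - x 3 ^ 2 * Real.sin (angle (x 2)) * Real.cos (angle (x 2)) := rfl
  rw [hgd, hb, hr] at hss
  rw [hrr, hbb, hb, hr]
  unfold Params.psi at hss
  generalize P.sDot x = sd at *
  generalize P.sDDot x z = sdd at *
  generalize P.omegaDDot x z = odd at *
  generalize P.filteredControl x z = u at *
  generalize P.psiDot x = pd at *
  generalize Real.cos (angle (x 2)) = C at *
  generalize Real.sin (angle (x 2)) = S at *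
  field_simp at hO hss
  constructor
  · apply mul_left_cancel₀ (mul_ne_zero hd hc)
    linear_combination (-1) * hss - (P.ϱ * P.M - P.L * C ^ 2) * hO
  · linear_combination (-1) * hO

end CartPendulum

end

noncomputable section

namespace CartPendulum

/-! ### Invariance, existence and attraction for compact sublevel sets. -/

section Dynamics

variable {E : Type*} [NormedAddCommGroup E] [NormedSpace ℝ E] {F : E → E} {W : E → ℝ}

/-! Along (S_μ) the derivative of `W_ρ` is `∇V(x)·f(x, z) - ρ⟨z, h(x, z)⟩ - ρ|z|²/μ`, where `h`
collects the accelerations. On a compact shell `C₀ ≤ W_ρ ≤ C₀ + n` the part without `μ` is negative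
where `z = 0`, by the decay of `V`, and where it is nonnegative `|z|` is bounded below, so the last
term wins for small `μ` (`exists_forall_sub_div_neg`). As `μ → 0` ever thicker shells become
admissible, whence `C(μ₁) → ∞`.

This fails to reach the origin: `V` is only `C¹`, so `∇V(x)` need not be `O(|x|)` and `∇V(x)·(f(x,
z) - f(x, 0))` need not be dominated by `|x|²` and `|z|²/μ`. A fixed neighbourhood of `0` is
therefore handled by a second function `V₁(x) + |z|²/2` with `V₁` of class `C²`
(`exists_local_decrease`). The shells bring a solution into a sublevel set of this second function,
which then gives stability and convergence (`isAttractionDomain_sublevel`).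

It remains to construct `V₁`. For `z = 0` the system is a cascade: `(s, γ)` decays exponentially and
drives the pendulum `Ω'' = -d₁Ω' - d₂ sinh Ω - d₃Ω'² tanh Ω + h`, with `h² ≤ k(s² + γ²)(1 + Ω'²)`.
The factor `cosh^(2d₃) Ω` removes the term cubic in velocity from the energy balance, and a small
cross term makes the energy `F` strictly dissipative when `h = 0`. The forcing contributes to `F'`
at most a multiple of `(s² + γ²)(1 + F)`, so `log(1 + F)` grows at most at a rate proportional to
`s² + γ²`; a quadratic form `Q(s, γ)` with sufficiently fast decay compensates this. Hence `V₁` is a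
multiple of `((1 + F)² exp(2Q) - 1)/2` (`lyapunov_decay_aux`, `exists_isLyapunov`). -/

theorem IsForwardSolution.continuousOn {y : ℝ → E} (hy : IsForwardSolution F y) :
    ContinuousOn y (Ici 0) := fun t ht => (hy t ht).continuousWithinAt

theorem IsForwardSolution.hasDerivWithinAt_comp {y : ℝ → E} (hy : IsForwardSolution F y)
    (hW : Differentiable ℝ W) {t : ℝ} (ht : 0 ≤ t) :
    HasDerivWithinAt (fun t => W (y t)) (fderiv ℝ W (y t) (F (y t))) (Ici t) t :=
  (((hW (y t)).hasFDerivAt.comp_hasDerivWithinAt t (hy t ht))).mono (Ici_subset_Ici.2 ht)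

theorem IsForwardSolution.continuousOn_comp {y : ℝ → E} (hy : IsForwardSolution F y)
    (hW : Differentiable ℝ W) : ContinuousOn (fun t => W (y t)) (Ici 0) :=
  hW.continuous.comp_continuousOn hy.continuousOn

theorem IsForwardSolution.shift {y : ℝ → E} (hy : IsForwardSolution F y) {τ : ℝ} (hτ : 0 ≤ τ) :
    IsForwardSolution F (fun t => y (t + τ)) := by
  intro t ht
  have h1 := hy (t + τ) (by positivity)
  have h2 : HasDerivWithinAt (fun t : ℝ => t + τ) 1 (Ici 0) t :=
    ((hasDerivAt_id t).add_const τ).hasDerivWithinAt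
  have h3 := h1.scomp t h2 (fun s hs => by
    simp only [mem_Ici] at hs ⊢; positivity)
  simpa using! h3

/-- A sublevel set on whose boundary `W` strictly decreases is positively invariant. -/
theorem IsForwardSolution.le_of_decreasing {y : ℝ → E} (hy : IsForwardSolution F y)
    (hW : Differentiable ℝ W) {c : ℝ} (hc : ∀ x, W x = c → fderiv ℝ W x (F x) < 0)
    (h0 : W (y 0) ≤ c) {t : ℝ} (ht : 0 ≤ t) : W (y t) ≤ c :=
  image_le_of_deriv_right_lt_deriv_boundary (B := fun _ => c) (B' := fun _ => 0)
    ((hy.continuousOn_comp hW).mono Icc_subset_Ici_self)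
    (fun _ hs => hy.hasDerivWithinAt_comp hW hs.1) h0 (fun _ => hasDerivAt_const _ _)
    (fun _ _ h => hc _ h) ⟨ht, le_rfl⟩

/-- A solution in a compact set on which `W` strictly decreases outside an open set `N`
meets `N`. -/
theorem IsForwardSolution.exists_mem {y : ℝ → E} (hy : IsForwardSolution F y)
    (hF : Continuous F) (hW : ContDiff ℝ 1 W) {K N : Set E} (hK : IsCompact K) (hN : IsOpen N)
    (hdec : ∀ x ∈ K, x ∉ N → fderiv ℝ W x (F x) < 0) (hyK : ∀ t, 0 ≤ t → y t ∈ K) :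
    ∃ t, 0 ≤ t ∧ y t ∈ N := by
  -- Otherwise the derivative of `W` along `y` is at most its maximum `-δ < 0` over the compact set
  -- `K \ N`, and the linear fall of `W` contradicts its lower bound `b` on `K`.
  by_contra! hcon
  have hcont : Continuous fun x => fderiv ℝ W x (F x) :=
    (hW.continuous_fderiv one_ne_zero).clm_apply hF
  have hKN : IsCompact (K \ N) := hK.diff hN
  have hne : (K \ N).Nonempty := ⟨y 0, hyK 0 le_rfl, hcon 0 le_rfl⟩
  obtain ⟨x₁, hx₁, hmax⟩ := hKN.exists_isMaxOn hne hcont.continuousOn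
  obtain ⟨b, hb⟩ := (hK.image hW.continuous).bddBelow
  set δ := -fderiv ℝ W x₁ (F x₁) with hδ
  have hδ0 : 0 < δ := by have := hdec x₁ hx₁.1 hx₁.2; linarith
  have hWd : Differentiable ℝ W := hW.differentiable one_ne_zero
  have key : ∀ t, 0 ≤ t → W (y t) ≤ W (y 0) - δ * t := by
    intro t ht
    refine image_le_of_deriv_right_le_deriv_boundary (B := fun t => W (y 0) - δ * t)
      (B' := fun _ => -δ) ((hy.continuousOn_comp hWd).mono Icc_subset_Ici_self)
      (fun _ hs => hy.hasDerivWithinAt_comp hWd hs.1) (by simp) (by fun_prop) ?_ ?_ ⟨ht, le_rfl⟩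
    · intro s _
      simpa using! (((hasDerivAt_id s).const_mul δ).const_sub (W (y 0))).hasDerivWithinAt
    · intro s hs
      have := hmax (show y s ∈ K \ N from ⟨hyK s hs.1, hcon s hs.1⟩)
      simp only [mem_ofPred_eq] at this
      linarith
  have hb0 : b ≤ W (y 0) := hb ⟨_, hyK 0 le_rfl, rfl⟩
  have ht0 : 0 ≤ (W (y 0) - b + 1) / δ := div_nonneg (by linarith) hδ0.le
  have h1 := key _ ht0
  have h2 : b ≤ W (y ((W (y 0) - b + 1) / δ)) := hb ⟨_, hyK _ ht0, rfl⟩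
  rw [mul_div_cancel₀ _ hδ0.ne'] at h1
  linarith

/-- A bounded, globally Lipschitz vector field has a forward solution from every point. -/
theorem exists_isForwardSolution_of_lipschitzWith [CompleteSpace E] {K B : NNReal}
    (hF : LipschitzWith K F) (hB : ∀ x, ‖F x‖ ≤ B) (y₀ : E) :
    ∃ y, IsForwardSolution F y ∧ y 0 = y₀ := by
  have hex : ∀ n : ℕ, ∃ y : ℝ → E, y 0 = y₀ ∧
      ∀ t ∈ Icc (0 : ℝ) n, HasDerivWithinAt y (F (y t)) (Icc 0 n) t := by
    intro n
    -- With speed at most `B` a solution travels at most `B * n` in time `n`, so Picard–Lindelöf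
    -- covers all of `[0, n]`; uniqueness then allows gluing over `n`.
    have hpl : IsPicardLindelof (fun _ => F) (⟨0, le_rfl, n.cast_nonneg⟩ : Icc (0 : ℝ) n) y₀
        (B * n) 0 B K :=
      IsPicardLindelof.of_time_independent (fun x _ => hB x) hF.lipschitzOnWith (by simp)
    exact hpl.exists_eq_forall_mem_Icc_hasDerivWithinAt₀
  choose Y hY0 hY using hex
  have hYc : ∀ n : ℕ, ContinuousOn (Y n) (Icc 0 n) := fun n t ht => (hY n t ht).continuousWithinAt
  have hYr : ∀ n : ℕ, ∀ t ∈ Ico (0 : ℝ) n, HasDerivWithinAt (Y n) (F (Y n t)) (Ici t) t := by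
    intro n t ht
    refine (hY n t ⟨ht.1, ht.2.le⟩).mono_of_mem_nhdsWithin ?_
    exact mem_of_superset (Icc_mem_nhdsGE ht.2) (Icc_subset_Icc_left ht.1)
  have huniq : ∀ m n : ℕ, m ≤ n → EqOn (Y m) (Y n) (Icc 0 m) := by
    intro m n hmn
    have hmn' : (m : ℝ) ≤ n := by exact_mod_cast hmn
    exact ODE_solution_unique (v := fun _ => F) (fun _ => hF) (hYc m) (hYr m)
      ((hYc n).mono (Icc_subset_Icc_right hmn'))
      (fun t ht => hYr n t ⟨ht.1, ht.2.trans_le hmn'⟩) (by rw [hY0, hY0])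
  have hcoh : ∀ (n : ℕ) (t : ℝ), 0 ≤ t → t ≤ n → Y ⌈t⌉₊ t = Y n t := fun n t h0 h1 =>
    huniq _ _ (Nat.ceil_le.2 h1) ⟨h0, Nat.le_ceil t⟩
  refine ⟨fun t => Y ⌈t⌉₊ t, fun t ht => ?_, by simp [hY0]⟩
  -- The extra `1` gives `t < n`, so `[0, n]` is a neighbourhood of `t` within `[0, ∞)`.
  set n := ⌈t⌉₊ + 1 with hn
  have htn : t < n := by rw [hn]; push_cast; linarith [Nat.le_ceil t]
  have hmem : Icc (0 : ℝ) n ∈ 𝓝[Ici 0] t := by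
    rw [← Ici_inter_Iic]
    exact inter_mem_nhdsWithin _ (Iic_mem_nhds htn)
  have h1 := (hY n t ⟨ht, htn.le⟩).mono_of_mem_nhdsWithin hmem
  have heq : (fun t => Y ⌈t⌉₊ t) =ᶠ[𝓝[Ici 0] t] Y n := by
    filter_upwards [hmem] with s hs using hcoh n s hs.1 hs.2
  simp only [hcoh n t ht htn.le]
  exact h1.congr_of_eventuallyEq heq (hcoh n t ht htn.le)

/-- Forward solutions exist from the points of a compact sublevel set on whose boundary `W`
strictly decreases. -/
theorem exists_isForwardSolution_of_isCompact [FiniteDimensional ℝ E] (hF : ContDiff ℝ 1 F)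
    (hW : Differentiable ℝ W) {c : ℝ} (hK : IsCompact {x | W x ≤ c})
    (hc : ∀ x, W x = c → fderiv ℝ W x (F x) < 0) {y₀ : E} (h0 : W y₀ ≤ c) :
    ∃ y, IsForwardSolution F y ∧ y 0 = y₀ := by
  obtain ⟨R, hR0, hR⟩ := hK.isBounded.subset_closedBall_lt 0 0
  -- The cut-off field is bounded and Lipschitz and equals `F` on the sublevel set, which its
  -- solutions cannot leave; they therefore solve the original equation.
  let χ : ContDiffBump (0 : E) := ⟨R, R + 1, hR0, by linarith⟩
  have hG : ContDiff ℝ 1 fun x => χ x • F x := χ.contDiff.smul hF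
  have hGc : HasCompactSupport fun x => χ x • F x := χ.hasCompactSupport.smul_right
  obtain ⟨k, hk⟩ := hG.lipschitzWith_of_hasCompactSupport hGc one_ne_zero
  obtain ⟨b, hb⟩ := hG.continuous.bounded_above_of_compact_support hGc
  have : CompleteSpace E := FiniteDimensional.complete ℝ E
  obtain ⟨y, hy, hy0⟩ := exists_isForwardSolution_of_lipschitzWith (B := b.toNNReal) hk
    (fun x => (hb x).trans (Real.le_coe_toNNReal b)) y₀
  have hχ : ∀ x, W x ≤ c → χ x • F x = F x := fun x hx => by
    rw [χ.one_of_mem_closedBall (hR hx), one_smul]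
  have hin : ∀ t, 0 ≤ t → W (y t) ≤ c := fun t ht =>
    hy.le_of_decreasing hW (fun x hx => by rw [hχ x hx.le]; exact hc x hx) (hy0 ▸ h0) ht
  refine ⟨y, fun t ht => ?_, hy0⟩
  simpa only [hχ _ (hin t ht)] using hy t ht

/-- A nonnegative continuous function with compact sublevel sets which vanishes only at `0` has
arbitrarily small sublevel sets. -/
theorem exists_sublevel_subset {E : Type*} [TopologicalSpace E] [Zero E] {Y : E → ℝ} (hY : Continuous Y) (hpos : ∀ x, x ≠ 0 → 0 < Y x)
    {c : ℝ} (hc : 0 < c) (hK : IsCompact {x | Y x ≤ c}) {U : Set E} (hU : U ∈ 𝓝 (0 : E)) :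
    ∃ c', 0 < c' ∧ c' ≤ c ∧ {x | Y x ≤ c'} ⊆ U := by
  have hKU : IsCompact ({x | Y x ≤ c} \ interior U) := hK.diff isOpen_interior
  have hint : (0 : E) ∈ interior U := mem_interior_iff_mem_nhds.2 hU
  rcases ({x | Y x ≤ c} \ interior U).eq_empty_or_nonempty with he | hne
  · exact ⟨c, hc, le_rfl, fun x hx => interior_subset (by
      by_contra h
      exact (he ▸ (⟨hx, h⟩ : x ∈ {x | Y x ≤ c} \ interior U) : x ∈ (∅ : Set E)))⟩
  · obtain ⟨x₁, hx₁, hmin⟩ := hKU.exists_isMinOn hne hY.continuousOn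
    have hx₁0 : x₁ ≠ 0 := fun h => hx₁.2 (h ▸ hint)
    have hp := hpos x₁ hx₁0
    refine ⟨min c (Y x₁ / 2), lt_min hc (by linarith), min_le_left _ _, fun x hx => ?_⟩
    by_contra h
    have hx' : Y x ≤ min c (Y x₁ / 2) := hx
    have := hmin (show x ∈ {x | Y x ≤ c} \ interior U from
      ⟨hx'.trans (min_le_left _ _), fun h' => h (interior_subset h')⟩)
    have h2 := hx'.trans (min_le_right _ _)
    simp only [mem_ofPred_eq] at this
    linarith

/-- Criterion for a sublevel set `{W ≤ C}` to be an attraction domain: `W` strictly decreases for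
`C₀ ≤ W ≤ C`, and `{W < C₀}` lies in a sublevel set of a local strict Lyapunov function `Y`. -/
theorem isAttractionDomain_sublevel [FiniteDimensional ℝ E] (hF : ContDiff ℝ 1 F)
    (hF0 : F 0 = 0) {Y : E → ℝ} (hY : ContDiff ℝ 1 Y) (hY0 : Y 0 = 0)
    (hYpos : ∀ x, x ≠ 0 → 0 < Y x) {c₁ : ℝ} (hc₁ : 0 < c₁) (hYK : IsCompact {x | Y x ≤ c₁})
    (hYdec : ∀ x, x ≠ 0 → Y x ≤ c₁ → fderiv ℝ Y x (F x) < 0)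
    (hW : ContDiff ℝ 1 W) {C₀ C : ℝ} (hC : C₀ ≤ C) (hW0 : W 0 < C₀) (hWK : IsCompact {x | W x ≤ C})
    (hWdec : ∀ x, C₀ ≤ W x → W x ≤ C → fderiv ℝ W x (F x) < 0)
    (hWY : ∀ x, W x < C₀ → Y x ≤ c₁) :
    IsAttractionDomain F {x | W x ≤ C} := by
  have hYd := hY.differentiable one_ne_zero
  have hWd := hW.differentiable one_ne_zero
  have hYinv : ∀ c, 0 < c → c ≤ c₁ → ∀ y, IsForwardSolution F y → Y (y 0) ≤ c →
      ∀ t, 0 ≤ t → Y (y t) ≤ c := fun c hc hcc y hy h0 t ht =>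
    hy.le_of_decreasing hYd (fun x hx => hYdec x (fun h => by rw [h, hY0] at hx; linarith)
      (hx.trans_le hcc)) h0 ht
  have hWinv : ∀ y, IsForwardSolution F y → W (y 0) ≤ C → ∀ t, 0 ≤ t → W (y t) ≤ C :=
    fun y hy h0 t ht => hy.le_of_decreasing hWd
      (fun x hx => hWdec x (hx ▸ hC) hx.le) h0 ht
  refine ⟨hF0, ?_, ?_, ?_, hWinv, ?_⟩
  · exact mem_of_superset ((isOpen_lt hW.continuous continuous_const).mem_nhds
      (show W 0 < C from hW0.trans_le hC)) fun x (hx : W x < C) => hx.le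
  · intro U hU
    obtain ⟨c, hc, hcc, hcU⟩ := exists_sublevel_subset hY.continuous hYpos hc₁ hYK hU
    refine ⟨{x | Y x < c}, (isOpen_lt hY.continuous continuous_const).mem_nhds
      (show Y 0 < c from hY0 ▸ hc), fun y hy h0 t ht => hcU ?_⟩
    exact hYinv c hc hcc y hy (le_of_lt h0) t ht
  · intro y₀ h0
    exact exists_isForwardSolution_of_isCompact hF hWd hWK
      (fun x hx => hWdec x (hx ▸ hC) hx.le) h0
  · intro y hy h0
    -- The solution enters `{W < C₀}` at time `τ`; from then on only `Y` is used, restarted at `τ`.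
    -- For each small `c` it enters `{Y < c}` and stays in `{Y ≤ c}`.
    obtain ⟨τ, hτ, hτN⟩ := hy.exists_mem hF.continuous hW hWK
      (isOpen_lt hW.continuous continuous_const : IsOpen {x | W x < C₀})
      (fun x hx hxN => hWdec x (not_lt.1 hxN) hx) (hWinv y hy h0)
    have hy' := hy.shift hτ
    have hy'0 : Y (y (0 + τ)) ≤ c₁ := by rw [zero_add]; exact hWY _ hτN
    have hin := hYinv c₁ hc₁ le_rfl _ hy' hy'0
    rw [tendsto_def]
    intro U hU
    obtain ⟨c, hc, hcc, hcU⟩ := exists_sublevel_subset hY.continuous hYpos hc₁ hYK hU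
    obtain ⟨τ', hτ', hτN'⟩ := hy'.exists_mem hF.continuous hY hYK
      (isOpen_lt hY.continuous continuous_const : IsOpen {x | Y x < c})
      (fun x hx hxN => hYdec x (fun h => hxN (by simpa [h, hY0] using hc)) hx) hin
    have hy'' := hy'.shift hτ'
    filter_upwards [eventually_ge_atTop (τ' + τ)] with t ht
    have := hYinv c hc hcc _ hy'' (by simpa using! le_of_lt hτN') (t - (τ' + τ)) (by linarith)
    refine hcU ?_
    have he : t - (τ' + τ) + τ' + τ = t := by ring
    rw [he] at this
    exact this

end Dynamics

/-! ### Composite Lyapunov functions for singularly perturbed systems. -/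

section SingularPerturbation

theorem isCompact_sublevel_of_tendsto {E : Type*} [TopologicalSpace E] {V : E → ℝ}
    (hV : Continuous V) (hp : Tendsto V (cocompact E) atTop) (c : ℝ) : IsCompact {x | V x ≤ c} := by
  obtain ⟨t, ht, hts⟩ := mem_cocompact.1 (hp (Ioi_mem_atTop c))
  refine ht.of_isClosed_subset (isClosed_le hV continuous_const) fun x hx => ?_
  by_contra h
  exact (show ¬c < V x from not_lt.2 hx) (hts h)

variable {X Z : Type*} [NormedAddCommGroup X] [NormedSpace ℝ X]
  [NormedAddCommGroup Z] [InnerProductSpace ℝ Z]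

/-- The singularly perturbed field `x' = f(x, z)`, `z' = -z / μ - h(x, z)`. -/
def perturbedField (f : X × Z → X) (h : X × Z → Z) (μ : ℝ) (y : X × Z) : X × Z :=
  (f y, -(μ⁻¹ • y.2) - h y)

/-- `V(x) + ρ |z|² / 2`. -/
def addQuadratic (V : X → ℝ) (ρ : ℝ) (y : X × Z) : ℝ := V y.1 + ρ * (‖y.2‖ ^ 2 / 2)

theorem contDiff_addQuadratic {V : X → ℝ} (hV : ContDiff ℝ 1 V) (ρ : ℝ) :
    ContDiff ℝ 1 (addQuadratic V ρ : X × Z → ℝ) :=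
  (hV.comp contDiff_fst).add (contDiff_const.mul ((contDiff_snd.norm_sq ℝ).div_const 2))

theorem fderiv_addQuadratic {V : X → ℝ} (hV : Differentiable ℝ V) (ρ : ℝ) (y v : X × Z) :
    fderiv ℝ (addQuadratic V ρ) y v = fderiv ℝ V y.1 v.1 + ρ * inner ℝ y.2 v.2 := by
  have h1 : HasFDerivAt (fun y : X × Z => V y.1) ((fderiv ℝ V y.1).comp
      (ContinuousLinearMap.fst ℝ X Z)) y := (hV y.1).hasFDerivAt.comp y hasFDerivAt_fst
  have h2 : HasFDerivAt (fun y : X × Z => ‖y.2‖ ^ 2) _ y :=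
    (hasFDerivAt_snd (𝕜 := ℝ) (E := X) (F := Z) (p := y)).norm_sq
  have h3 := h1.add (((h2.const_mul (2⁻¹ : ℝ))).const_mul ρ)
  have h4 : (addQuadratic V ρ : X × Z → ℝ) =
      (fun y => V y.1) + fun y => ρ * (2⁻¹ * ‖y.2‖ ^ 2) := by
    funext y; simp only [addQuadratic, Pi.add_apply]; ring
  rw [h4, h3.fderiv]
  simp

omit [NormedSpace ℝ X] [InnerProductSpace ℝ Z] in
theorem addQuadratic_pos {V : X → ℝ} (h0 : V 0 = 0) (hpos : ∀ x, x ≠ 0 → 0 < V x) {ρ : ℝ}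
    (hρ : 0 < ρ) (y : X × Z) (hy : y ≠ 0) : 0 < addQuadratic V ρ y := by
  have hV : 0 ≤ V y.1 := by
    rcases eq_or_ne y.1 0 with h | h
    · rw [h, h0]
    · exact (hpos _ h).le
  rcases eq_or_ne y.2 0 with h | h
  · have : y.1 ≠ 0 := fun h' => hy (Prod.ext h' h)
    have := hpos _ this
    unfold addQuadratic; positivity
  · have := norm_pos_iff.2 h
    unfold addQuadratic; positivity

omit [NormedSpace ℝ X] [InnerProductSpace ℝ Z] in
theorem isCompact_sublevel_addQuadratic [ProperSpace Z] {V : X → ℝ} (hV : Continuous V)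
    (h0 : V 0 = 0) (hpos : ∀ x, x ≠ 0 → 0 < V x) (hK : ∀ c, IsCompact {x | V x ≤ c}) {ρ : ℝ}
    (hρ : 0 < ρ) (c : ℝ) : IsCompact {y : X × Z | addQuadratic V ρ y ≤ c} := by
  have hcl : IsClosed {y : X × Z | addQuadratic V ρ y ≤ c} := by
    refine isClosed_le ?_ continuous_const
    unfold addQuadratic
    fun_prop
  refine ((hK c).prod (isCompact_closedBall (0 : Z) (√(2 * c / ρ)))).of_isClosed_subset hcl ?_
  rintro ⟨x, z⟩ hy
  have hy' : V x + ρ * (‖z‖ ^ 2 / 2) ≤ c := hy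
  have hV0 : 0 ≤ V x := by
    rcases eq_or_ne x 0 with h | h
    · rw [h, h0]
    · exact (hpos _ h).le
  have hq : 0 ≤ ρ * (‖z‖ ^ 2 / 2) := by positivity
  refine ⟨show V x ≤ c by linarith, ?_⟩
  rw [mem_closedBall_zero_iff]
  apply Real.le_sqrt_of_sq_le
  rw [le_div_iff₀ hρ]
  linarith

/-- Isolates `-ρ|z|²/μ`, the only term in which `μ` occurs. -/
theorem fderiv_addQuadratic_perturbedField {V : X → ℝ} (hV : Differentiable ℝ V) (ρ μ : ℝ)
    (f : X × Z → X) (h : X × Z → Z) (y : X × Z) :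
    fderiv ℝ (addQuadratic V ρ) y (perturbedField f h μ y) =
      fderiv ℝ V y.1 (f y) - ρ * inner ℝ y.2 (h y) - ρ * ‖y.2‖ ^ 2 / μ := by
  rw [fderiv_addQuadratic hV]
  simp only [perturbedField, inner_sub_right, inner_neg_right, inner_smul_right,
    real_inner_self_eq_norm_sq]
  ring

/-- If `g < 0` on the part of a compact set where `q = 0`, then `g - q / μ < 0` on all of it, for
small `μ`. -/
theorem exists_forall_sub_div_neg {E : Type*} [TopologicalSpace E] {g q : E → ℝ}
    (hg : Continuous g) (hq : Continuous q) (hq0 : ∀ y, 0 ≤ q y) {K : Set E} (hK : IsCompact K)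
    (hneg : ∀ y ∈ K, q y = 0 → g y < 0) :
    ∃ μs : ℝ, 0 < μs ∧ ∀ μ, 0 < μ → μ ≤ μs → ∀ y ∈ K, g y - q y / μ < 0 := by
  -- Only the points with `0 ≤ g` matter. There `q` has a positive minimum and `g` a finite maximum,
  -- and `μs` is the former divided by the latter plus `1`.
  have hK' : IsCompact (K ∩ {y | 0 ≤ g y}) := hK.inter_right (isClosed_le continuous_const hg)
  have htriv : ∀ μ : ℝ, 0 < μ → ∀ y, g y < 0 → g y - q y / μ < 0 := fun μ hμ y hy => by
    have := div_nonneg (hq0 y) hμ.le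
    linarith
  rcases (K ∩ {y | 0 ≤ g y}).eq_empty_or_nonempty with he | hne
  · refine ⟨1, one_pos, fun μ hμ _ y hy => htriv μ hμ y ?_⟩
    by_contra hcon
    exact (he ▸ (⟨hy, not_lt.1 hcon⟩ : y ∈ K ∩ {y | 0 ≤ g y}) : y ∈ (∅ : Set E))
  · obtain ⟨y₁, hy₁, hmin⟩ := hK'.exists_isMinOn hne hq.continuousOn
    obtain ⟨y₂, hy₂, hmax⟩ := hK'.exists_isMaxOn hne hg.continuousOn
    have hη : 0 < q y₁ := (hq0 y₁).lt_of_ne fun h =>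
      absurd (hneg y₁ hy₁.1 h.symm) (not_lt.2 hy₁.2)
    have hG : 0 ≤ g y₂ := hy₂.2
    refine ⟨q y₁ / (g y₂ + 1), by positivity, fun μ hμ hμs y hy => ?_⟩
    by_cases hgy : 0 ≤ g y
    · have h1 : q y₁ ≤ q y := hmin (show y ∈ K ∩ {y | 0 ≤ g y} from ⟨hy, hgy⟩)
      have h2 : g y ≤ g y₂ := hmax (show y ∈ K ∩ {y | 0 ≤ g y} from ⟨hy, hgy⟩)
      rw [le_div_iff₀ (by positivity)] at hμs
      have : g y₂ + 1 ≤ q y / μ := by rw [le_div_iff₀ hμ]; linarith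
      linarith
    · exact htriv μ hμ y (not_le.1 hgy)

/-- Near the origin `V(x) + |z|² / 2` strictly decreases along the perturbed field for all small
`μ`, if the Lyapunov function `V` is twice continuously differentiable. -/
theorem exists_local_decrease {f : X × Z → X} {h : X × Z → Z} (hf : ContDiff ℝ 1 f)
    (hh : ContDiff ℝ 1 h) (hh0 : h 0 = 0) {V : X → ℝ} (hV : ContDiff ℝ 2 V)
    (hV0 : V 0 = 0) (hpos : ∀ x, x ≠ 0 → 0 < V x)
    (hdec : ∀ x, fderiv ℝ V x (f (x, 0)) ≤ -‖x‖ ^ 2) :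
    ∃ U ∈ 𝓝 (0 : X × Z), ∃ μ₀ : ℝ, 0 < μ₀ ∧ ∀ μ, 0 < μ → μ ≤ μ₀ → ∀ y ∈ U, y ≠ 0 →
      fderiv ℝ (addQuadratic V 1) y (perturbedField f h μ y) < 0 := by
  -- This is where `C²` is needed: `∇V` is Lipschitz near its zero at the minimum `0`, so `|∇V(x)| ≤
  -- d|x|`.
  have hdV : ContDiff ℝ 1 (fderiv ℝ V) := hV.fderiv_right (by norm_num)
  have hmin : IsLocalMin V 0 := Eventually.of_forall fun x => by
    rcases eq_or_ne x 0 with h | h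
    · rw [h]
    · rw [hV0]; exact (hpos x h).le
  have hdV0 : fderiv ℝ V 0 = 0 := hmin.fderiv_eq_zero
  obtain ⟨k₁, t₁, ht₁, hL₁⟩ := (hf.contDiffAt (x := 0)).exists_lipschitzOnWith
  obtain ⟨k₂, t₂, ht₂, hL₂⟩ := (hh.contDiffAt (x := 0)).exists_lipschitzOnWith
  obtain ⟨k₃, t₃, ht₃, hL₃⟩ := (hdV.contDiffAt (x := 0)).exists_lipschitzOnWith
  obtain ⟨r₁, hr₁, hb₁⟩ := Metric.mem_nhds_iff.1 (inter_mem ht₁ ht₂)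
  obtain ⟨r₂, hr₂, hb₂⟩ := Metric.mem_nhds_iff.1 ht₃
  set a := (k₁ : ℝ)
  set b := (k₂ : ℝ)
  set d := (k₃ : ℝ)
  have ha : 0 ≤ a := k₁.2
  have hb : 0 ≤ b := k₂.2
  have hd : 0 ≤ d := k₃.2
  set m := d * a + b with hm
  have hm0 : 0 ≤ m := by positivity
  -- The derivative is at most `-|x|² + m|x||z| + b|z|² - |z|²/μ`. Completing the square costs
  -- `m²|z|²/2`, so `1/μ ≥ m² + b + 1` suffices.
  refine ⟨Metric.ball 0 (min r₁ r₂), Metric.ball_mem_nhds _ (lt_min hr₁ hr₂),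
    1 / (m ^ 2 + b + 1), by positivity, ?_⟩
  rintro μ hμ hμ₀ ⟨x, z⟩ hy hy0
  rw [mem_ball_zero_iff, Prod.norm_mk, max_lt_iff] at hy
  have hx1 : ‖x‖ < r₁ := hy.1.trans_le (min_le_left _ _)
  have hx2 : ‖x‖ < r₂ := hy.1.trans_le (min_le_right _ _)
  have hz1 : ‖z‖ < r₁ := hy.2.trans_le (min_le_left _ _)
  have hm1 : (x, z) ∈ t₁ ∩ t₂ := hb₁ (by simp [Prod.norm_mk, hx1, hz1])
  have hm2 : (x, (0 : Z)) ∈ t₁ ∩ t₂ := hb₁ (by simp [Prod.norm_mk, hx1])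
  have hm3 : (0 : X × Z) ∈ t₁ ∩ t₂ := hb₁ (by simpa using hr₁)
  have hm4 : x ∈ t₃ := hb₂ (by simpa using hx2)
  have hm5 : (0 : X) ∈ t₃ := hb₂ (by simpa using hr₂)
  have e1 : ‖f (x, z) - f (x, 0)‖ ≤ a * ‖z‖ := by
    simpa [Prod.norm_mk] using hL₁.norm_sub_le hm1.1 hm2.1
  have e2 : ‖h (x, z)‖ ≤ b * (‖x‖ + ‖z‖) := by
    have h1 := hL₂.norm_sub_le hm1.2 hm3.2
    rw [hh0, sub_zero, sub_zero, Prod.norm_mk] at h1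
    refine h1.trans (mul_le_mul_of_nonneg_left ?_ hb)
    exact max_le (by linarith [norm_nonneg z]) (by linarith [norm_nonneg x])
  have e3 : ‖fderiv ℝ V x‖ ≤ d * ‖x‖ := by
    have h1 := hL₃.norm_sub_le hm4 hm5
    rwa [hdV0, sub_zero, sub_zero] at h1
  rw [fderiv_addQuadratic_perturbedField (hV.differentiable two_ne_zero)]
  have e4 : fderiv ℝ V x (f (x, z)) ≤ -‖x‖ ^ 2 + d * ‖x‖ * (a * ‖z‖) := by
    have h1 : fderiv ℝ V x (f (x, z)) =
        fderiv ℝ V x (f (x, 0)) + fderiv ℝ V x (f (x, z) - f (x, 0)) := by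
      rw [map_sub]; ring
    have h2 : fderiv ℝ V x (f (x, z) - f (x, 0)) ≤ d * ‖x‖ * (a * ‖z‖) :=
      (le_abs_self _).trans (((fderiv ℝ V x).le_opNorm _).trans
        (mul_le_mul e3 e1 (norm_nonneg _) (by positivity)))
    linarith [hdec x]
  have e5 : -inner ℝ z (h (x, z)) ≤ ‖z‖ * (b * (‖x‖ + ‖z‖)) := by
    have h1 := abs_real_inner_le_norm z (h (x, z))
    have h2 := mul_le_mul_of_nonneg_left e2 (norm_nonneg z)
    linarith [neg_abs_le (inner ℝ z (h (x, z)))]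
  have e6 : (m ^ 2 + b + 1) * ‖z‖ ^ 2 ≤ ‖z‖ ^ 2 / μ := by
    rw [le_div_iff₀ hμ]
    rw [le_div_iff₀ (by positivity)] at hμ₀
    nlinarith [sq_nonneg ‖z‖]
  have e7 : 0 < ‖x‖ ^ 2 + ‖z‖ ^ 2 := by
    rcases eq_or_ne x 0 with h | h
    · have hz : z ≠ 0 := fun h' => hy0 (Prod.ext h h')
      have := norm_pos_iff.2 hz
      positivity
    · have := norm_pos_iff.2 h
      positivity
  simp only [one_mul]
  have e8 : d * ‖x‖ * (a * ‖z‖) + ‖z‖ * (b * (‖x‖ + ‖z‖)) = m * (‖x‖ * ‖z‖) + b * ‖z‖ ^ 2 := by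
    rw [hm]; ring
  nlinarith [sq_nonneg (‖x‖ - m * ‖z‖), sq_nonneg (m * ‖z‖)]

/-- Semiglobal stability of a singularly perturbed system whose unperturbed system has a Lyapunov
function `V`, and a Lyapunov function `V₁` which is twice continuously differentiable. -/
theorem exists_attractionDomain_perturbedField [FiniteDimensional ℝ X] [FiniteDimensional ℝ Z]
    {f : X × Z → X} {h : X × Z → Z} (hf : ContDiff ℝ 1 f) (hh : ContDiff ℝ 1 h) (hf0 : f 0 = 0)
    (hh0 : h 0 = 0) {V₁ : X → ℝ} (hV₁ : ContDiff ℝ 2 V₁) (hV₁0 : V₁ 0 = 0)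
    (hV₁pos : ∀ x, x ≠ 0 → 0 < V₁ x) (hV₁K : ∀ c, IsCompact {x | V₁ x ≤ c})
    (hV₁dec : ∀ x, fderiv ℝ V₁ x (f (x, 0)) ≤ -‖x‖ ^ 2) {V : X → ℝ} (hV : ContDiff ℝ 1 V)
    (hV0 : V 0 = 0) (hVpos : ∀ x, x ≠ 0 → 0 < V x) (hVK : ∀ c, IsCompact {x | V x ≤ c})
    (hVdec : ∀ x, fderiv ℝ V x (f (x, 0)) ≤ -‖x‖ ^ 2) {ρ : ℝ} (hρ : 0 < ρ) :
    ∃ (C : ℝ → ℝ) (μ₀ : ℝ), 0 < μ₀ ∧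
      (∀ μ₁ : ℝ, 0 < μ₁ → μ₁ ≤ μ₀ → 0 < C μ₁ ∧ ∀ μ : ℝ, 0 < μ → μ ≤ μ₁ →
        IsAttractionDomain (perturbedField f h μ) {y | addQuadratic V ρ y ≤ C μ₁}) ∧
      Tendsto C (𝓝[>] 0) atTop := by
  classical
  have : ProperSpace Z := FiniteDimensional.proper ℝ Z
  have hV1 : ContDiff ℝ 1 V₁ := hV₁.of_le (by norm_num)
  have hVd := hV.differentiable one_ne_zero
  have hY : ContDiff ℝ 1 (addQuadratic V₁ 1 : X × Z → ℝ) := contDiff_addQuadratic hV1 1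
  have hW : ContDiff ℝ 1 (addQuadratic V ρ : X × Z → ℝ) := contDiff_addQuadratic hV ρ
  have hYpos := addQuadratic_pos (Z := Z) hV₁0 hV₁pos one_pos
  have hWpos := addQuadratic_pos (Z := Z) hV0 hVpos hρ
  have hYK := isCompact_sublevel_addQuadratic (Z := Z) hV1.continuous hV₁0 hV₁pos hV₁K one_pos
  have hWK := isCompact_sublevel_addQuadratic (Z := Z) hV.continuous hV0 hVpos hVK hρ
  have hY0 : addQuadratic V₁ 1 (0 : X × Z) = 0 := by simp [addQuadratic, hV₁0]
  have hW0 : addQuadratic V ρ (0 : X × Z) = 0 := by simp [addQuadratic, hV0]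
  obtain ⟨U, hU, μl, hμl, hloc⟩ := exists_local_decrease hf hh hh0 hV₁ hV₁0 hV₁pos hV₁dec
  obtain ⟨c₁, hc₁, -, hc₁U⟩ := exists_sublevel_subset hY.continuous hYpos one_pos (hYK 1) hU
  -- Neither `c₁` nor `C₀` depends on `μ`: the local decrease holds on one neighbourhood for all `μ
  -- ≤ μl`.
  obtain ⟨C₀, hC₀, -, hC₀Y⟩ := exists_sublevel_subset hW.continuous hWpos one_pos (hWK 1)
    ((isOpen_lt hY.continuous continuous_const).mem_nhds
      (show addQuadratic V₁ 1 (0 : X × Z) < c₁ by rwa [hY0]))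
  have hdecr : ∀ n : ℕ, ∃ μs : ℝ, 0 < μs ∧ ∀ μ, 0 < μ → μ ≤ μs → ∀ y : X × Z,
      C₀ ≤ addQuadratic V ρ y → addQuadratic V ρ y ≤ C₀ + n →
      fderiv ℝ (addQuadratic V ρ) y (perturbedField f h μ y) < 0 := by
    intro n
    have hK : IsCompact ({y : X × Z | addQuadratic V ρ y ≤ C₀ + n} ∩
        {y | C₀ ≤ addQuadratic V ρ y}) :=
      (hWK _).inter_right (isClosed_le continuous_const hW.continuous)
    have hg : Continuous fun y : X × Z => fderiv ℝ V y.1 (f y) - ρ * inner ℝ y.2 (h y) := by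
      have h1 : Continuous fun y : X × Z => fderiv ℝ V y.1 (f y) :=
        ((hV.continuous_fderiv one_ne_zero).comp continuous_fst).clm_apply hf.continuous
      exact h1.sub (continuous_const.mul (continuous_snd.inner hh.continuous))
    have hq : Continuous fun y : X × Z => ρ * ‖y.2‖ ^ 2 := by fun_prop
    obtain ⟨μs, hμs, H⟩ := exists_forall_sub_div_neg hg hq (fun y => by positivity) hK (by
      rintro ⟨x, z⟩ hy hz
      have hz0 : z = 0 := by simpa [hρ.ne'] using hz
      subst hz0
      have hx : x ≠ 0 := by
        rintro rfl
        have h1 : C₀ ≤ addQuadratic V ρ (0 : X × Z) := hy.2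
        rw [hW0] at h1
        linarith
      have := norm_pos_iff.2 hx
      have h2 := hVdec x
      simp only [inner_zero_left, mul_zero, sub_zero]
      nlinarith)
    exact ⟨μs, hμs, fun μ hμ hμs y h1 h2 => by
      rw [fderiv_addQuadratic_perturbedField hVd]
      exact H μ hμ hμs y ⟨h2, h1⟩⟩
  choose μs hμs hdecr using hdecr
  let good : ℝ → ℕ → Prop := fun μ₁ n => ∀ μ, 0 < μ → μ ≤ μ₁ → ∀ y : X × Z,
      C₀ ≤ addQuadratic V ρ y → addQuadratic V ρ y ≤ C₀ + n →
      fderiv ℝ (addQuadratic V ρ) y (perturbedField f h μ y) < 0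
  have hgood : ∀ n μ₁, μ₁ ≤ μs n → good μ₁ n := fun n μ₁ hμ₁ μ hμ hle =>
    hdecr n μ hμ (hle.trans hμ₁)
  -- The thickest admissible shell, capped at `1/μ₁` so that a maximum exists. Since `n = 0` is
  -- admissible once `μ₁ ≤ μs 0`, the default value `0` is harmless. Each fixed `n` is admissible
  -- and below the cap for small `μ₁`, so `N → ∞` without any monotonicity of `μs`.
  let N : ℝ → ℕ := fun μ₁ => Nat.findGreatest (good μ₁) ⌊μ₁⁻¹⌋₊
  refine ⟨fun μ₁ => C₀ + N μ₁, min μl (μs 0), lt_min hμl (hμs 0), fun μ₁ hμ₁ hle => ?_, ?_⟩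
  · have hN : good μ₁ (N μ₁) := Nat.findGreatest_spec (Nat.zero_le _)
      (hgood 0 μ₁ (hle.trans (min_le_right _ _)))
    refine ⟨by positivity, fun μ hμ hμle => ?_⟩
    refine isAttractionDomain_sublevel ?_ ?_ hY hY0 hYpos hc₁ (hYK c₁) ?_ hW (C₀ := C₀) ?_ ?_
      (hWK _) (hN μ hμ hμle) ?_
    · exact hf.prodMk (((contDiff_const.smul contDiff_snd).neg).sub hh)
    · simp [perturbedField, hf0, hh0]
    · exact fun y hy hyc => hloc μ hμ (hμle.trans (hle.trans (min_le_left _ _))) y (hc₁U hyc) hy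
    · exact le_add_of_nonneg_right (Nat.cast_nonneg _)
    · rwa [hW0]
    · exact fun y hy => le_of_lt (hC₀Y (show addQuadratic V ρ y ≤ C₀ from hy.le))
  · refine tendsto_atTop_add_const_left _ _ (tendsto_natCast_atTop_atTop.comp ?_)
    refine tendsto_atTop.2 fun n => ?_
    have h1 : ∀ᶠ μ₁ : ℝ in 𝓝[>] 0, (n : ℝ) ≤ μ₁⁻¹ :=
      tendsto_inv_nhdsGT_zero.eventually_ge_atTop (n : ℝ)
    have h2 : ∀ᶠ μ₁ : ℝ in 𝓝[>] 0, μ₁ < μs n :=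
      (eventually_lt_nhds (hμs n)).filter_mono nhdsWithin_le_nhds
    filter_upwards [h1, h2] with μ₁ h1 h2
    exact Nat.le_findGreatest (Nat.le_floor h1) (hgood n μ₁ h2.le)

end SingularPerturbation

/-! ### The angle as the Gudermannian of `Ω`: trigonometric functions become hyperbolic. -/

theorem cos_angle_pos (Ω : ℝ) : 0 < Real.cos (angle Ω) :=
  Real.cos_pos_of_mem_Ioo (angle_mem Ω)

theorem angle_eq (Ω : ℝ) : angle Ω = Real.pi / 2 - 2 * Real.arctan (Real.exp (-Ω)) := by
  unfold angle; ring

theorem cos_angle (Ω : ℝ) : Real.cos (angle Ω) = (Real.cosh Ω)⁻¹ := by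
  rw [angle_eq, Real.cos_pi_div_two_sub, Real.sin_two_mul, Real.sin_arctan, Real.cos_arctan,
    Real.cosh_eq]
  have h1 : (0 : ℝ) < 1 + Real.exp (-Ω) ^ 2 := by positivity
  have h2 := Real.sq_sqrt h1.le
  have h3 : Real.exp Ω * Real.exp (-Ω) = 1 := by rw [← Real.exp_add]; simp
  have h4 := Real.exp_pos Ω
  have h5 := Real.exp_pos (-Ω)
  have h6 := Real.sqrt_pos.2 h1
  field_simp
  rw [h2]
  linear_combination h3

theorem sin_angle (Ω : ℝ) : Real.sin (angle Ω) = Real.sinh Ω / Real.cosh Ω := by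
  rw [angle_eq, Real.sin_pi_div_two_sub, Real.cos_two_mul, Real.cos_sq_arctan,
    Real.cosh_eq, Real.sinh_eq]
  have h1 : (0 : ℝ) < 1 + Real.exp (-Ω) ^ 2 := by positivity
  have h3 : Real.exp Ω * Real.exp (-Ω) = 1 := by rw [← Real.exp_add]; simp
  have h4 := Real.exp_pos Ω
  have h5 := Real.exp_pos (-Ω)
  field_simp
  linear_combination (-2 * Real.exp (-Ω)) * h3

theorem tan_angle (Ω : ℝ) : Real.tan (angle Ω) = Real.sinh Ω := by
  rw [Real.tan_eq_sin_div_cos, sin_angle, cos_angle]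
  have := Real.cosh_pos Ω
  field_simp

theorem angle_zero : angle 0 = 0 := by
  simp [angle]

theorem contDiff_angle {n : WithTop ℕ∞} : ContDiff ℝ n angle := by
  have h : ContDiff ℝ n fun Ω : ℝ => Real.arctan (Real.exp (-Ω)) :=
    Real.contDiff_arctan.comp (Real.contDiff_exp.comp contDiff_neg)
  unfold angle
  fun_prop

/-! ### Smoothness of the closed loop and its reduction to the abstract system. -/

namespace Params

variable (P : Params)

theorem psi_pos (hP : P.Admissible) (β : ℝ) : 0 < P.psi β := by
  unfold psi
  have h1 := Real.cos_sq_le_one β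
  have h2 := hP.inertia
  nlinarith [sq_nonneg P.L]

section Smoothness

variable {E : Type*} [NormedAddCommGroup E] [NormedSpace ℝ E] {n : WithTop ℕ∞} {x : E → X}
  {z : E → Z}

theorem contDiff_sDot (hP : P.Admissible) (hx : ContDiff ℝ n x) :
    ContDiff ℝ n fun e => P.sDot (x e) := by
  have hx' := contDiff_euclidean.1 hx
  have hang := contDiff_angle.comp (hx' 2)
  unfold sDot
  refine ((hx' 1).div ?_ fun e => (P.psi_pos hP _).ne').sub (contDiff_const.mul (hx' 0))
  exact contDiff_const.sub (contDiff_const.mul (hang.cos.pow 2))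

theorem contDiff_control {s Ω v w : E → ℝ} (hs : ContDiff ℝ n s)
    (hΩ : ContDiff ℝ n Ω) (hv : ContDiff ℝ n v) (hw : ContDiff ℝ n w) :
    ContDiff ℝ n fun e => P.control (s e) (angle (Ω e)) (v e) (w e) := by
  have hang := contDiff_angle.comp hΩ
  have hcos := hang.cos
  have hsin := hang.sin
  have hinv : ContDiff ℝ n fun e => (Real.cos (angle (Ω e)))⁻¹ :=
    hcos.inv fun e => (cos_angle_pos _).ne'
  simp only [Function.comp_apply] at hcos hsin
  simp only [control, signal, gain, Fin.sum_univ_succ, Finset.univ_eq_empty, Finset.sum_empty,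
      Matrix.cons_val_zero, Matrix.cons_val_succ, Real.sin_two_mul, Real.tan_eq_sin_div_cos,
      div_eq_mul_inv, ← inv_pow]
  fun_prop

theorem contDiff_psi {Ω : E → ℝ} (hΩ : ContDiff ℝ n Ω) :
    ContDiff ℝ n fun e => P.psi (angle (Ω e)) :=
  contDiff_const.sub (contDiff_const.mul ((contDiff_angle.comp hΩ).cos.pow 2))

theorem contDiff_rDot (hP : P.Admissible) (hx : ContDiff ℝ n x) :
    ContDiff ℝ n fun e => P.rDot (x e) :=
  (P.contDiff_sDot hP hx).sub (contDiff_const.mul (contDiff_euclidean.1 hx 3))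

theorem contDiff_betaDot (hx : ContDiff ℝ n x) : ContDiff ℝ n fun e => betaDot (x e) :=
  have hx' := contDiff_euclidean.1 hx
  (hx' 3).mul (contDiff_angle.comp (hx' 2)).cos

theorem contDiff_gammaDot (hP : P.Admissible) (hx : ContDiff ℝ n x) (hz : ContDiff ℝ n z) :
    ContDiff ℝ n fun e => P.gammaDot (x e) (z e) := by
  have hx' := contDiff_euclidean.1 hx
  have hz' := contDiff_euclidean.1 hz
  have hr := P.contDiff_rDot hP hx
  have hb := contDiff_betaDot hx
  exact (contDiff_const.mul (hx' 1)).sub (contDiff_const.mul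
    ((P.contDiff_control (hx' 0) (hx' 2) (hr.add (hz' 0)) (hb.add (hz' 1))).sub
      (P.contDiff_control (hx' 0) (hx' 2) hr hb)))

theorem contDiff_sDDot (hP : P.Admissible) (hx : ContDiff ℝ n x) (hz : ContDiff ℝ n z) :
    ContDiff ℝ n fun e => P.sDDot (x e) (z e) := by
  have hx' := contDiff_euclidean.1 hx
  have hψ := P.contDiff_psi (hx' 2)
  have hψ' : ContDiff ℝ n fun e => P.psiDot (x e) :=
    (contDiff_const.mul (contDiff_betaDot hx)).mul
      (contDiff_const.mul (contDiff_angle.comp (hx' 2))).sin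
  exact ((((P.contDiff_gammaDot hP hx hz).mul hψ).sub ((hx' 1).mul hψ')).div (hψ.pow 2)
    fun e => pow_ne_zero 2 (P.psi_pos hP _).ne').sub (contDiff_const.mul (P.contDiff_sDot hP hx))

theorem contDiff_omegaDDot (hP : P.Admissible) (hx : ContDiff ℝ n x) (hz : ContDiff ℝ n z) :
    ContDiff ℝ n fun e => P.omegaDDot (x e) (z e) := by
  have hx' := contDiff_euclidean.1 hx
  have hs := P.contDiff_sDot hP hx
  have hss := P.contDiff_sDDot hP hx hz
  have hsin := (contDiff_angle.comp (hx' 2)).sin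
  have hsinh := (hx' 2).sinh
  simp only [Function.comp_apply] at hsin
  unfold omegaDDot
  -- In the coordinate `Ω` the tangent is `sinh Ω`, smooth on the whole line.
  simp only [tan_angle]
  fun_prop

theorem contDiff_slowField (hP : P.Admissible) (hx : ContDiff ℝ n x) (hz : ContDiff ℝ n z) :
    ContDiff ℝ n fun e => P.slowField (x e) (z e) := by
  refine contDiff_euclidean.2 fun i => ?_
  fin_cases i
  · exact P.contDiff_sDot hP hx
  · exact P.contDiff_gammaDot hP hx hz
  · exact contDiff_euclidean.1 hx 3
  · exact P.contDiff_omegaDDot hP hx hz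

theorem contDiff_accelerations (hP : P.Admissible) (hx : ContDiff ℝ n x) (hz : ContDiff ℝ n z) :
    ContDiff ℝ n fun e => (!₂[P.rDDot (x e) (z e), P.betaDDot (x e) (z e)] : Z) := by
  have hx' := contDiff_euclidean.1 hx
  have hO := P.contDiff_omegaDDot hP hx hz
  have hsin := (contDiff_angle.comp (hx' 2)).sin
  have hcos := (contDiff_angle.comp (hx' 2)).cos
  refine contDiff_euclidean.2 fun i => ?_
  fin_cases i
  · exact (P.contDiff_sDDot hP hx hz).sub (contDiff_const.mul hO)
  · exact (hO.mul hcos).sub ((((hx' 3).pow 2).mul hsin).mul hcos)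

end Smoothness

theorem gammaDot_zero_right (x : X) : P.gammaDot x 0 = -P.a * x 1 := by
  simp [gammaDot, filteredControl, exactControl]

theorem sDot_zero : P.sDot 0 = 0 := by simp [sDot]

theorem sDDot_zero : P.sDDot 0 0 = 0 := by simp [sDDot, sDot_zero, gammaDot_zero_right]

theorem omegaDDot_zero : P.omegaDDot 0 0 = 0 := by
  simp [omegaDDot, sDDot_zero, sDot_zero, angle_zero]

theorem slowField_zero : P.slowField 0 0 = 0 := by
  ext i
  fin_cases i <;> simp [slowField, sDot_zero, gammaDot_zero_right, omegaDDot_zero]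

theorem accelerations_zero : (!₂[P.rDDot 0 0, P.betaDDot 0 0] : Z) = 0 := by
  ext i
  fin_cases i <;> simp [rDDot, betaDDot, sDDot_zero, omegaDDot_zero]

theorem field_eq_perturbedField {μ : ℝ} (hμ : μ ≠ 0) :
    P.field μ = perturbedField (fun y : X × Z => P.slowField y.1 y.2)
      (fun y => !₂[P.rDDot y.1 y.2, P.betaDDot y.1 y.2]) μ := by
  funext y
  refine Prod.ext rfl ?_
  ext i
  fin_cases i <;> simp [field, perturbedField] <;> field_simp

theorem IsLyapunov.isCompact_sublevel {P : Params} {V : X → ℝ} (hV : P.IsLyapunov V) (c : ℝ) :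
    IsCompact {x | V x ≤ c} :=
  isCompact_sublevel_of_tendsto hV.contDiff.continuous hV.proper c

/-- Semiglobal stability for every Lyapunov function of the unperturbed system, if one of them is
twice continuously differentiable. -/
theorem exists_attractionDomain {P : Params} (hP : P.Admissible) {V₁ : X → ℝ}
    (hV₁ : P.IsLyapunov V₁) (hV₁2 : ContDiff ℝ 2 V₁) {V : X → ℝ} (hV : P.IsLyapunov V) {ρ : ℝ}
    (hρ : 0 < ρ) :
    ∃ (C : ℝ → ℝ) (μ₀ : ℝ), 0 < μ₀ ∧
      (∀ μ₁ : ℝ, 0 < μ₁ → μ₁ ≤ μ₀ → 0 < C μ₁ ∧ ∀ μ : ℝ, 0 < μ → μ ≤ μ₁ →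
        IsAttractionDomain (P.field μ) {y | composite V ρ y ≤ C μ₁}) ∧
      Tendsto C (𝓝[>] 0) atTop ∧
      (∀ K : Set (X × Z), IsCompact K →
        ∀ᶠ μ₁ in 𝓝[>] (0 : ℝ), K ⊆ {y | composite V ρ y ≤ C μ₁}) := by
  obtain ⟨C, μ₀, hμ₀, hC, hlim⟩ := exists_attractionDomain_perturbedField
    (P.contDiff_slowField hP contDiff_fst contDiff_snd)
    (P.contDiff_accelerations hP contDiff_fst contDiff_snd) P.slowField_zero P.accelerations_zero
    hV₁2 hV₁.zero hV₁.pos hV₁.isCompact_sublevel hV₁.decay hV.contDiff hV.zero hV.pos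
    hV.isCompact_sublevel hV.decay hρ
  refine ⟨C, μ₀, hμ₀, fun μ₁ h1 h2 => ⟨(hC μ₁ h1 h2).1, fun μ hμ hle => ?_⟩, hlim, fun K hK => ?_⟩
  · rw [P.field_eq_perturbedField hμ.ne']
    exact (hC μ₁ h1 h2).2 μ hμ hle
  · obtain ⟨b, hb⟩ := (hK.image (contDiff_addQuadratic hV.contDiff ρ).continuous).bddAbove
    filter_upwards [hlim.eventually_ge_atTop b] with μ₁ h y hy
    exact (hb (mem_image_of_mem _ hy)).trans h
end Params

/-! ### The weighted energy of the pendulum and its dissipation. -/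

/-- Energy of the pendulum `Ω'' = -d₁ Ω' - d sinh Ω - (p / 2) Ω'² tanh Ω`, weighted by the
integrating factor `coshᵖ Ω`, with a cross term of size `ε`. -/
def weightedEnergy (p d ε Ω ω : ℝ) : ℝ :=
  Real.cosh Ω ^ p * ω ^ 2 / 2 + d * (Real.cosh Ω * Real.cosh Ω ^ p - 1) / (p + 1)
    + ε * (ω * (Real.sinh Ω / Real.cosh Ω) * Real.cosh Ω ^ p)

theorem contDiff_weightedEnergy {E : Type*} [NormedAddCommGroup E] [NormedSpace ℝ E]
    {n : WithTop ℕ∞} (p d ε : ℝ) {Ω ω : E → ℝ} (hΩ : ContDiff ℝ n Ω) (hω : ContDiff ℝ n ω) :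
    ContDiff ℝ n fun e => weightedEnergy p d ε (Ω e) (ω e) := by
  have hC := hΩ.cosh
  have hq : ContDiff ℝ n fun e => Real.cosh (Ω e) ^ p :=
    hC.rpow_const_of_ne fun e => (Real.cosh_pos _).ne'
  have hT : ContDiff ℝ n fun e => Real.sinh (Ω e) / Real.cosh (Ω e) :=
    hΩ.sinh.div hC fun e => (Real.cosh_pos _).ne'
  unfold weightedEnergy
  fun_prop

theorem weightedEnergy_zero (p d ε : ℝ) : weightedEnergy p d ε 0 0 = 0 := by
  simp [weightedEnergy]

/-- The weight `coshᵖ` factors out of every term. With `p = 2d₃` its own derivative contributes `d₃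
tanh Ω · ω³`, which cancels the quadratic velocity force. -/
theorem hasDerivAt_weightedEnergy {p d : ℝ} (ε : ℝ) (hp : p + 1 ≠ 0) {Ω ω : ℝ → ℝ} {Ω' ω' t : ℝ}
    (hΩ : HasDerivAt Ω Ω' t) (hω : HasDerivAt ω ω' t) :
    HasDerivAt (fun t => weightedEnergy p d ε (Ω t) (ω t))
      (Real.cosh (Ω t) ^ p * (ω t * ω' + p / 2 * (Real.sinh (Ω t) / Real.cosh (Ω t)) * ω t ^ 2 * Ω'
        + d * Real.sinh (Ω t) * Ω'
        + ε * (ω' * (Real.sinh (Ω t) / Real.cosh (Ω t))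
          + ω t * Ω' * (1 + (p - 1) * (Real.sinh (Ω t) / Real.cosh (Ω t)) ^ 2)))) t := by
  have hC0 := Real.cosh_pos (Ω t)
  have hC := hΩ.cosh
  have hS := hΩ.sinh
  have hq := hC.rpow_const (p := p) (Or.inl hC0.ne')
  rw [Real.rpow_sub_one hC0.ne'] at hq
  have hT := hS.div hC hC0.ne'
  have h : HasDerivAt (fun t => weightedEnergy p d ε (Ω t) (ω t)) _ t :=
    ((((hq.mul (hω.pow 2)).div_const 2).add
      ((((hC.mul hq).sub_const 1).const_mul d).div_const (p + 1))).add
      (((hω.mul hT).mul hq).const_mul ε))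
  refine h.congr_deriv ?_
  simp only [Pi.div_apply, Pi.mul_apply, Pi.pow_apply]
  generalize Real.cosh (Ω t) ^ p = q
  generalize Real.cosh (Ω t) = c at *
  generalize Real.sinh (Ω t) = s at *
  push_cast
  field_simp
  ring

theorem one_add_sq_div_two_le_cosh (x : ℝ) : 1 + x ^ 2 / 2 ≤ Real.cosh x := by
  have h1 : Real.cosh x = 1 + 2 * Real.sinh (x / 2) ^ 2 := by
    have h := Real.cosh_two_mul (x / 2)
    rw [mul_div_cancel₀ _ two_ne_zero, Real.cosh_sq] at h
    linarith
  have h2 : (x / 2) ^ 2 ≤ Real.sinh (x / 2) ^ 2 := by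
    rw [sq_le_sq, Real.abs_sinh]
    exact Real.self_le_sinh_iff.2 (abs_nonneg _)
  linarith

theorem sq_le_sinh_sq (x : ℝ) : x ^ 2 ≤ Real.sinh x ^ 2 := by
  rw [sq_le_sq, Real.abs_sinh]
  exact Real.self_le_sinh_iff.2 (abs_nonneg _)

theorem tanh_sq_eq (x : ℝ) : (Real.sinh x / Real.cosh x) ^ 2 = 1 - 1 / Real.cosh x ^ 2 := by
  have := Real.cosh_pos x
  have h := Real.cosh_sq x
  field_simp
  linarith

/-- The cross term is split by completing a square: half of the kinetic energy absorbs one part, and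
`tanh² ≤ 2(cosh - 1)` lets half of the potential energy absorb the other when `ε` is small. -/
theorem le_weightedEnergy {p d ε : ℝ} (hp : 0 ≤ p) (hε : ε ^ 2 ≤ d / (4 * (p + 1)))
    (Ω ω : ℝ) :
    Real.cosh Ω ^ p * ω ^ 2 / 4 + d / (2 * (p + 1)) * (Real.cosh Ω * Real.cosh Ω ^ p - 1)
      ≤ weightedEnergy p d ε Ω ω := by
  unfold weightedEnergy
  have hC := Real.one_le_cosh Ω
  have hq := Real.one_le_rpow hC hp
  have hT := tanh_sq_eq Ω
  set c := Real.cosh Ω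
  set q := c ^ p
  set T := Real.sinh Ω / c
  have hc0 : 0 < c := by linarith
  have h1 : T ^ 2 ≤ 2 * (c - 1) := by
    rw [hT]
    have : 1 - 1 / c ^ 2 = (c - 1) * ((c + 1) / c ^ 2) := by field_simp; ring
    rw [this, mul_comm 2]
    refine mul_le_mul_of_nonneg_left ?_ (by linarith)
    rw [div_le_iff₀ (by positivity)]
    nlinarith
  have h2 : T ^ 2 * q ≤ 2 * (c * q - 1) := by nlinarith
  have h3 : ε ^ 2 * (T ^ 2 * q) ≤ d / (4 * (p + 1)) * (2 * (c * q - 1)) :=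
    mul_le_mul hε h2 (by positivity) ((sq_nonneg ε).trans hε)
  have h4 : d / (4 * (p + 1)) * (2 * (c * q - 1)) = d / (2 * (p + 1)) * (c * q - 1) := by
    field_simp; ring
  have h5 : d * (c * q - 1) / (p + 1) = 2 * (d / (2 * (p + 1)) * (c * q - 1)) := by
    field_simp
  have h6 : 0 ≤ q * (ω / 2 + ε * T) ^ 2 := by positivity
  rw [h5]
  rw [h4] at h3
  nlinarith

/-- Here `T` stands for `tanh Ω` and `c` for `cosh Ω`, with the weight divided out. Damping controls
`ω` only; the cross term supplies the negative `c T²`, and its `ω²` errors, of size `ε`, are paid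
for by the damping. Young's inequality leaves a multiple of `h²`. -/
theorem pendulum_dissipation {d₁ d₂ d₃ ε c T h ω : ℝ} (h1 : 0 < d₁) (h2 : 0 < d₂) (h3 : 0 ≤ d₃)
    (hε : 0 ≤ ε) (hε' : ε * (d₁ ^ 2 / d₂ + 1 + d₃) ≤ d₁ / 4) (hc : 1 ≤ c) (hT : T ^ 2 ≤ 1) :
    -d₁ * ω ^ 2 + ω * h + ε * (-d₁ * ω * T - d₂ * c * T ^ 2 + h * T
      + ω ^ 2 * (1 - T ^ 2 + d₃ * T ^ 2)) ≤
    -(d₁ / 4) * ω ^ 2 - ε * d₂ / 2 * (c * T ^ 2) + (1 / d₁ + ε / d₂) * h ^ 2 := by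
  have e1 : ω * h ≤ d₁ / 4 * ω ^ 2 + 1 / d₁ * h ^ 2 := by
    have : 0 ≤ d₁ * (ω / 2 - h / d₁) ^ 2 := by positivity
    have e : d₁ * (ω / 2 - h / d₁) ^ 2 = d₁ / 4 * ω ^ 2 + 1 / d₁ * h ^ 2 - ω * h := by
      field_simp; ring
    linarith
  have e2 : -d₁ * ω * T ≤ d₂ / 4 * T ^ 2 + d₁ ^ 2 / d₂ * ω ^ 2 := by
    have : 0 ≤ d₂ * (T / 2 + d₁ / d₂ * ω) ^ 2 := by positivity
    have e : d₂ * (T / 2 + d₁ / d₂ * ω) ^ 2 =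
      d₂ / 4 * T ^ 2 + d₁ ^ 2 / d₂ * ω ^ 2 + d₁ * ω * T := by
      field_simp; ring
    linarith
  have e3 : h * T ≤ d₂ / 4 * T ^ 2 + 1 / d₂ * h ^ 2 := by
    have : 0 ≤ d₂ * (T / 2 - h / d₂) ^ 2 := by positivity
    have e : d₂ * (T / 2 - h / d₂) ^ 2 = d₂ / 4 * T ^ 2 + 1 / d₂ * h ^ 2 - h * T := by
      field_simp; ring
    linarith
  have e4 : ω ^ 2 * (1 - T ^ 2 + d₃ * T ^ 2) ≤ (1 + d₃) * ω ^ 2 := by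
    have : 1 - T ^ 2 + d₃ * T ^ 2 ≤ 1 + d₃ := by nlinarith [sq_nonneg T]
    nlinarith [sq_nonneg ω]
  have e5 : d₂ * T ^ 2 ≤ d₂ * (c * T ^ 2) := by nlinarith [mul_nonneg h2.le (sq_nonneg T)]
  have e6 : -d₁ * ω * T - d₂ * c * T ^ 2 + h * T + ω ^ 2 * (1 - T ^ 2 + d₃ * T ^ 2) ≤
      (d₁ ^ 2 / d₂ + 1 + d₃) * ω ^ 2 - d₂ / 2 * (c * T ^ 2) + 1 / d₂ * h ^ 2 := by linarith
  have e7 := mul_le_mul_of_nonneg_left e6 hε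
  have e8 := mul_le_mul_of_nonneg_right hε' (sq_nonneg ω)
  have e9 : ε * ((d₁ ^ 2 / d₂ + 1 + d₃) * ω ^ 2 - d₂ / 2 * (c * T ^ 2) + 1 / d₂ * h ^ 2) =
    ε * (d₁ ^ 2 / d₂ + 1 + d₃) * ω ^ 2 - ε * d₂ / 2 * (c * T ^ 2) + ε / d₂ * h ^ 2 := by ring
  nlinarith [mul_nonneg h1.le (sq_nonneg ω)]

/-! ### Bounds on the forcing by the cascade `(s, γ)`. -/

namespace Params

variable (P : Params)

/-- The acceleration of the cart coordinate `s` which drives the pendulum. -/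
def forcing (x : X) : ℝ := (P.L * P.sDDot x 0 + P.κ * P.sDot x) / (P.ϱ * P.L - P.I)

theorem psi_lower (β : ℝ) : P.M * P.I - P.L ^ 2 ≤ P.psi β := by
  unfold psi
  nlinarith [Real.cos_sq_le_one β, sq_nonneg P.L]

theorem abs_sDot_le (hP : P.Admissible) (x : X) :
    |P.sDot x| ≤ (1 / (P.M * P.I - P.L ^ 2) + P.α) * (|x 0| + |x 1|) := by
  have hm : 0 < P.M * P.I - P.L ^ 2 := sub_pos.2 hP.inertia
  have hψ := P.psi_lower (angle (x 2))
  have h1 : |x 1 / P.psi (angle (x 2))| ≤ 1 / (P.M * P.I - P.L ^ 2) * |x 1| := by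
    rw [abs_div, abs_of_pos (hm.trans_le hψ), one_div_mul_eq_div]
    gcongr
  have h2 : |P.α * x 0| = P.α * |x 0| := by rw [abs_mul, abs_of_pos hP.α_pos]
  have h3 := abs_sub (x 1 / P.psi (angle (x 2))) (P.α * x 0)
  have h4 : 0 < 1 / (P.M * P.I - P.L ^ 2) := by positivity
  have h5 := mul_nonneg h4.le (abs_nonneg (x 0))
  have h6 := mul_nonneg hP.α_pos.le (abs_nonneg (x 1))
  unfold sDot
  nlinarith

theorem abs_psiDot_le (x : X) : |P.psiDot x| ≤ P.L ^ 2 * |x 3| := by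
  unfold psiDot betaDot
  rw [abs_mul, abs_mul, abs_mul, abs_of_nonneg (sq_nonneg P.L)]
  have h1 := Real.abs_cos_le_one (angle (x 2))
  have h2 := Real.abs_sin_le_one (2 * angle (x 2))
  have h3 : 0 ≤ P.L ^ 2 * |x 3| := by positivity
  calc P.L ^ 2 * (|x 3| * |Real.cos (angle (x 2))|) * |Real.sin (2 * angle (x 2))|
      = P.L ^ 2 * |x 3| * (|Real.cos (angle (x 2))| * |Real.sin (2 * angle (x 2))|) := by ring
    _ ≤ P.L ^ 2 * |x 3| * 1 :=
      mul_le_mul_of_nonneg_left (mul_le_one₀ h1 (abs_nonneg _) h2) h3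
    _ = _ := mul_one _

/-- All terms are linear in `(s, γ)`; the factor `1 + Ω'²` enters only through `ψ'`, which is
bounded by a multiple of `|Ω'|`, while `ψ` is bounded below. -/
theorem exists_forcing_sq_le (hP : P.Admissible) :
    ∃ k, 0 ≤ k ∧ ∀ x : X, P.forcing x ^ 2 ≤ k * ((x 0 ^ 2 + x 1 ^ 2) * (1 + x 3 ^ 2)) := by
  have hm : 0 < P.M * P.I - P.L ^ 2 := sub_pos.2 hP.inertia
  have hD : 0 < P.ϱ * P.L - P.I := sub_pos.2 hP.rho_L
  have hL : 0 < P.L := mul_pos hP.m_pos hP.l_pos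
  have ha := hP.a_pos
  have hα := hP.α_pos
  have hκ := hP.κ_pos
  set m := P.M * P.I - P.L ^ 2
  set D := P.ϱ * P.L - P.I with hDdef
  set k₂ := 1 / m + P.α
  set k₃ := P.a / m + P.L ^ 2 / m ^ 2 + P.α * k₂
  set k₁ := (P.L * k₃ + P.κ * k₂) / D
  have hk₂ : 0 < k₂ := by positivity
  have hk₃ : 0 < k₃ := by positivity
  have hk₁ : 0 < k₁ := by positivity
  refine ⟨4 * k₁ ^ 2, by positivity, fun x => ?_⟩
  have hs := P.abs_sDot_le hP x
  have hψ := P.psi_lower (angle (x 2))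
  have hψ0 := hm.trans_le hψ
  have hψd := P.abs_psiDot_le x
  set Y := |x 0| + |x 1| with hY
  have hY0 : 0 ≤ Y := by positivity
  have hγY : |x 1| ≤ Y := by linarith [abs_nonneg (x 0)]
  have e1 : |P.sDDot x 0| ≤ k₃ * (Y * (1 + |x 3|)) := by
    have e : P.sDDot x 0 = -(P.a * x 1 / P.psi (angle (x 2)))
        + -(x 1 * P.psiDot x / P.psi (angle (x 2)) ^ 2) + -(P.α * P.sDot x) := by
      unfold sDDot
      rw [gammaDot_zero_right]
      field_simp
      ring
    have f1 : |P.a * x 1 / P.psi (angle (x 2))| ≤ P.a / m * Y := by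
      rw [abs_div, abs_mul, abs_of_pos ha, abs_of_pos hψ0, div_mul_eq_mul_div]
      gcongr
    have f2 : |x 1 * P.psiDot x / P.psi (angle (x 2)) ^ 2| ≤ P.L ^ 2 / m ^ 2 * (Y * |x 3|) := by
      rw [abs_div, abs_mul, abs_of_pos (pow_pos hψ0 2), div_mul_eq_mul_div]
      have : |x 1| * |P.psiDot x| ≤ P.L ^ 2 * (Y * |x 3|) := by
        calc |x 1| * |P.psiDot x| ≤ Y * (P.L ^ 2 * |x 3|) :=
              mul_le_mul hγY hψd (abs_nonneg _) hY0
          _ = _ := by ring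
      gcongr
    have f3 : |P.α * P.sDot x| ≤ P.α * (k₂ * Y) := by
      rw [abs_mul, abs_of_pos hα]
      gcongr
    have f4 := abs_add_three (-(P.a * x 1 / P.psi (angle (x 2))))
      (-(x 1 * P.psiDot x / P.psi (angle (x 2)) ^ 2)) (-(P.α * P.sDot x))
    rw [abs_neg, abs_neg, abs_neg, ← e] at f4
    have g1 : 0 ≤ P.a / m * (Y * |x 3|) := by positivity
    have g2 : 0 ≤ P.L ^ 2 / m ^ 2 * Y := by positivity
    have g3 : 0 ≤ P.α * k₂ * (Y * |x 3|) := by positivity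
    calc |P.sDDot x 0| ≤ P.a / m * Y + P.L ^ 2 / m ^ 2 * (Y * |x 3|) + P.α * (k₂ * Y) := by linarith
      _ ≤ (P.a / m + P.L ^ 2 / m ^ 2 + P.α * k₂) * (Y * (1 + |x 3|)) := by linarith
  have e2 : |P.forcing x| ≤ k₁ * (Y * (1 + |x 3|)) := by
    unfold forcing
    rw [abs_div, abs_of_pos hD, div_mul_eq_mul_div]
    have f1 := abs_add_le (P.L * P.sDDot x 0) (P.κ * P.sDot x)
    rw [abs_mul, abs_mul, abs_of_pos hL, abs_of_pos hκ] at f1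
    have f2 : P.L * |P.sDDot x 0| ≤ P.L * (k₃ * (Y * (1 + |x 3|))) := by gcongr
    have f3 : P.κ * |P.sDot x| ≤ P.κ * (k₂ * Y) := by gcongr
    have f4 : 0 ≤ P.κ * k₂ * (Y * |x 3|) := by positivity
    gcongr
    linarith
  calc P.forcing x ^ 2 = |P.forcing x| ^ 2 := (sq_abs _).symm
    _ ≤ (k₁ * (Y * (1 + |x 3|))) ^ 2 := by gcongr
    _ = k₁ ^ 2 * (Y ^ 2 * (1 + |x 3|) ^ 2) := by ring
    _ ≤ k₁ ^ 2 * ((2 * (x 0 ^ 2 + x 1 ^ 2)) * (2 * (1 + x 3 ^ 2))) := by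
      have f1 : Y ^ 2 ≤ 2 * (x 0 ^ 2 + x 1 ^ 2) := by
        rw [hY, ← sq_abs (x 0), ← sq_abs (x 1)]; exact add_sq_le
      have f2 : (1 + |x 3|) ^ 2 ≤ 2 * (1 + x 3 ^ 2) := by
        rw [← sq_abs (x 3)]; nlinarith [sq_nonneg (1 - |x 3|)]
      gcongr
    _ = _ := by ring

theorem omegaDDot_zero_right (x : X) :
    P.omegaDDot x 0 = -P.d₁ * x 3 - P.d₂ * Real.sinh (x 2)
      - P.d₃ * x 3 ^ 2 * (Real.sinh (x 2) / Real.cosh (x 2)) + P.forcing x := by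
  unfold omegaDDot forcing
  rw [tan_angle, sin_angle]

end Params

/-! ### Growth of the energy and the decay estimate for the combined function. -/

/-- The weight multiplying the forcing is at most linear in `1 + F`, which makes the logarithmic
compensation by `Q` possible. -/
theorem weight_le_weightedEnergy {p d ε : ℝ} (hp : 0 ≤ p) (hd : 0 < d)
    (hε : ε ^ 2 ≤ d / (4 * (p + 1))) (Ω ω : ℝ) :
    Real.cosh Ω * Real.cosh Ω ^ p ≤ (5 + 2 * (p + 1) / d) * (1 + weightedEnergy p d ε Ω ω) ∧
    Real.cosh Ω ^ p * (1 + ω ^ 2) ≤ (5 + 2 * (p + 1) / d) * (1 + weightedEnergy p d ε Ω ω) := by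
  have hlow := le_weightedEnergy hp hε Ω ω
  have hc := Real.one_le_cosh Ω
  have hq := Real.one_le_rpow hc hp
  set F := weightedEnergy p d ε Ω ω
  set c := Real.cosh Ω
  set q := c ^ p
  have hcq : q ≤ c * q := le_mul_of_one_le_left (by linarith) hc
  have h0 : 0 ≤ q * ω ^ 2 / 4 := by positivity
  have h1 : 0 ≤ d / (2 * (p + 1)) * (c * q - 1) := mul_nonneg (by positivity) (by linarith)
  have h2 : 0 < 2 * (p + 1) / d := by positivity
  have h3 := mul_le_mul_of_nonneg_left (show d / (2 * (p + 1)) * (c * q - 1) ≤ F by linarith) h2.le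
  have h4 : 2 * (p + 1) / d * (d / (2 * (p + 1)) * (c * q - 1)) = c * q - 1 := by field_simp
  constructor <;> linarith

theorem quadratic_le_weightedEnergy {p d ε : ℝ} (hp : 0 ≤ p) (hd : 0 ≤ d)
    (hε : ε ^ 2 ≤ d / (4 * (p + 1))) (Ω ω : ℝ) :
    ω ^ 2 / 4 + d / (4 * (p + 1)) * Ω ^ 2 ≤ weightedEnergy p d ε Ω ω := by
  refine le_trans ?_ (le_weightedEnergy hp hε Ω ω)
  have hq := Real.one_le_rpow (Real.one_le_cosh Ω) hp
  have f1 : ω ^ 2 ≤ Real.cosh Ω ^ p * ω ^ 2 := le_mul_of_one_le_left (sq_nonneg _) hq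
  have f2 := one_add_sq_div_two_le_cosh Ω
  have f3 : Real.cosh Ω ≤ Real.cosh Ω * Real.cosh Ω ^ p :=
    le_mul_of_one_le_right (Real.cosh_pos _).le hq
  have f4 : d / (2 * (p + 1)) * (Ω ^ 2 / 2) ≤
    d / (2 * (p + 1)) * (Real.cosh Ω * Real.cosh Ω ^ p - 1) :=
    mul_le_mul_of_nonneg_left (by linarith) (by positivity)
  have f5 : d / (2 * (p + 1)) * (Ω ^ 2 / 2) = d / (4 * (p + 1)) * Ω ^ 2 := by
    field_simp; ring
  linarith

theorem exists_pos_mul_le_sq_le {u a v : ℝ} (hu : 0 < u) (ha : 0 < a) (hv : 0 < v) :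
    ∃ ε : ℝ, 0 < ε ∧ ε * u ≤ a ∧ ε ^ 2 ≤ v := by
  have hmin : 0 < min (a / u) (√v) := lt_min (by positivity) (Real.sqrt_pos.2 hv)
  refine ⟨_, hmin, (le_div_iff₀ hu).1 (min_le_left _ _), ?_⟩
  calc min (a / u) (√v) ^ 2 ≤ √v ^ 2 := pow_le_pow_left₀ hmin.le (min_le_right _ _) 2
    _ = v := Real.sq_sqrt hv.le

/-- Read `Φ = 1 + F`, `e = exp(2Q)`, `N = s² + γ²`, `c = cosh Ω`, `c * T = sinh Ω`. As `q(1 + ω²) ≤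
BΦ`, the forcing costs at most `k'BNΦ²`, which `Φ²Q'` outweighs by `NΦ²`. The extra factor `Φ` due
to the square gives, through `cq ≤ BΦ`, control of `sinh² Ω ≥ Ω²`; the factor `1 + B / δ` normalises
the decay to `-|x|²`. -/
theorem lyapunov_decay_aux {δ B k' Φ q c e T Ω ω N F' Q' : ℝ} (hδ : 0 < δ) (hB : 1 ≤ B)
    (hk' : 0 ≤ k') (hΦ : 1 ≤ Φ) (hq : 1 ≤ q) (hc : 1 ≤ c) (he : 1 ≤ e) (hcq : c * q ≤ B * Φ)
    (hqω : q * (1 + ω ^ 2) ≤ B * Φ) (hT : Ω ^ 2 ≤ (c * T) ^ 2) (hN : 0 ≤ N)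
    (hF' : F' ≤ q * (-δ * (ω ^ 2 + c * T ^ 2) + k' * (N * (1 + ω ^ 2))))
    (hQ' : Q' ≤ -(k' * B + 1) * N) :
    (1 + B / δ) * (e * (Φ * F' + Φ ^ 2 * Q')) ≤ -(N + Ω ^ 2 + ω ^ 2) := by
  have hΦ0 : 0 < Φ := by linarith
  have hq0 : 0 < q := by linarith
  have hc0 : 0 < c := by linarith
  have hB0 : 0 < B := by linarith
  set η := δ * (Φ * q * (ω ^ 2 + c * T ^ 2)) + N with hη
  have hη0 : 0 ≤ η := by positivity
  have h1 : Φ * F' + Φ ^ 2 * Q' ≤ -η := by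
    have f1 := mul_le_mul_of_nonneg_left hF' hΦ0.le
    have f2 := mul_le_mul_of_nonneg_left hQ' (sq_nonneg Φ)
    have f3 := mul_le_mul_of_nonneg_left hqω (mul_nonneg (mul_nonneg hk' hN) hΦ0.le)
    have f4 : N ≤ Φ ^ 2 * N := le_mul_of_one_le_left hN (one_le_pow₀ hΦ)
    rw [hη]
    linarith
  have h2 : Ω ^ 2 ≤ B * (Φ * q * (c * T ^ 2)) := by
    have f1 : 0 ≤ q * (c * T ^ 2) := by positivity
    have f2 := mul_le_mul_of_nonneg_right hcq f1
    have f3 : (c * T) ^ 2 ≤ q ^ 2 * (c * T) ^ 2 :=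
      le_mul_of_one_le_left (sq_nonneg _) (one_le_pow₀ hq)
    linarith
  have h3 : ω ^ 2 ≤ B * (Φ * q * ω ^ 2) := by
    have : 1 ≤ B * (Φ * q) := one_le_mul_of_one_le_of_one_le hB
      (one_le_mul_of_one_le_of_one_le hΦ hq)
    have := le_mul_of_one_le_left (sq_nonneg ω) this
    linarith
  have h4 : N + Ω ^ 2 + ω ^ 2 ≤ (1 + B / δ) * η := by
    have f1 : B / δ * η = B * (Φ * q * (ω ^ 2 + c * T ^ 2)) + B / δ * N := by
      rw [hη]; field_simp
    have f2 : 0 ≤ B / δ * N := by positivity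
    have f3 : 0 ≤ δ * (Φ * q * (ω ^ 2 + c * T ^ 2)) := by positivity
    have f4 : N ≤ η := by linarith
    linarith
  have h5 : e * (Φ * F' + Φ ^ 2 * Q') ≤ -η := by nlinarith
  have h6 := mul_le_mul_of_nonneg_left h5 (show 0 ≤ 1 + B / δ by positivity)
  linarith

/-! ### Assembly of the twice differentiable Lyapunov function. -/

namespace Params

variable (P : Params)

theorem sDot_mul_le (hP : P.Admissible) (x : X) :
    x 0 * P.sDot x ≤
      -(P.α / 2) * x 0 ^ 2 + 1 / (2 * P.α * (P.M * P.I - P.L ^ 2) ^ 2) * x 1 ^ 2 := by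
  have hm : 0 < P.M * P.I - P.L ^ 2 := sub_pos.2 hP.inertia
  have hψ := P.psi_lower (angle (x 2))
  have hα := hP.α_pos
  unfold sDot
  set m := P.M * P.I - P.L ^ 2
  set ψ := P.psi (angle (x 2))
  have hψ0 : 0 < ψ := hm.trans_le hψ
  have h1 : 1 / (2 * P.α * ψ ^ 2) * x 1 ^ 2 ≤ 1 / (2 * P.α * m ^ 2) * x 1 ^ 2 := by gcongr
  have h2 : 0 ≤ P.α / 2 * (x 0 - x 1 / (P.α * ψ)) ^ 2 := by positivity
  have h3 : P.α / 2 * (x 0 - x 1 / (P.α * ψ)) ^ 2 =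
      P.α / 2 * x 0 ^ 2 + 1 / (2 * P.α * ψ ^ 2) * x 1 ^ 2 - x 0 * (x 1 / ψ) := by
    field_simp
    ring
  linarith

theorem norm_sq_eq (x : X) : ‖x‖ ^ 2 = x 0 ^ 2 + x 1 ^ 2 + x 2 ^ 2 + x 3 ^ 2 := by
  rw [EuclideanSpace.real_norm_sq_eq, Fin.sum_univ_four]

/-- A twice continuously differentiable function with at least quadratic growth and the decay
property is a Lyapunov function. -/
theorem IsLyapunov.of_quadratic_le {P : Params} {V : X → ℝ} (hV : ContDiff ℝ 1 V) (h0 : V 0 = 0)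
    {b : ℝ} (hb : 0 < b) (hle : ∀ x, b * ‖x‖ ^ 2 ≤ V x)
    (hdec : ∀ x, fderiv ℝ V x (P.slowField x 0) ≤ -‖x‖ ^ 2) : P.IsLyapunov V where
  contDiff := hV
  zero := h0
  pos x hx := by
    have := norm_pos_iff.2 hx
    exact lt_of_lt_of_le (by positivity) (hle x)
  proper := tendsto_atTop_mono hle
    (((tendsto_pow_atTop two_ne_zero).comp tendsto_norm_cocompact_atTop).const_mul_atTop hb)
  decay := hdec

/-- The weighted energy dissipates up to terms in `s` and `γ`. -/
theorem exists_energy_dissipation (hP : P.Admissible) (hd₁ : 0 < P.d₁) (hd₂ : 0 < P.d₂)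
    (hd₃ : 0 < P.d₃) :
    ∃ ε δ k : ℝ, ε ^ 2 ≤ P.d₂ / (4 * (2 * P.d₃ + 1)) ∧ 0 < δ ∧ 0 ≤ k ∧ ∀ (x : X) (c T : ℝ),
      1 ≤ c → T ^ 2 ≤ 1 →
      x 3 * (-P.d₁ * x 3 - P.d₂ * (c * T) - P.d₃ * x 3 ^ 2 * T + P.forcing x)
        + 2 * P.d₃ / 2 * T * x 3 ^ 2 * x 3 + P.d₂ * (c * T) * x 3
        + ε * ((-P.d₁ * x 3 - P.d₂ * (c * T) - P.d₃ * x 3 ^ 2 * T + P.forcing x) * T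
          + x 3 * x 3 * (1 + (2 * P.d₃ - 1) * T ^ 2)) ≤
        -δ * (x 3 ^ 2 + c * T ^ 2) + k * ((x 0 ^ 2 + x 1 ^ 2) * (1 + x 3 ^ 2)) := by
  obtain ⟨k₀, hk₀, hforce⟩ := P.exists_forcing_sq_le hP
  have hu : 0 < P.d₁ ^ 2 / P.d₂ + 1 + P.d₃ := by positivity
  have hv : 0 < P.d₂ / (4 * (2 * P.d₃ + 1)) := by positivity
  obtain ⟨ε, hε, hε1, hε2⟩ := exists_pos_mul_le_sq_le hu (show 0 < P.d₁ / 4 by positivity) hv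
  refine ⟨ε, min (P.d₁ / 4) (ε * P.d₂ / 2), (1 / P.d₁ + ε / P.d₂) * k₀, hε2,
    lt_min (by positivity) (by positivity), by positivity, fun x c T hc hT => ?_⟩
  have hdis := pendulum_dissipation (h := P.forcing x) (ω := x 3) hd₁ hd₂ hd₃.le hε.le hε1 hc hT
  have f1 : min (P.d₁ / 4) (ε * P.d₂ / 2) * x 3 ^ 2 ≤ P.d₁ / 4 * x 3 ^ 2 :=
    mul_le_mul_of_nonneg_right (min_le_left _ _) (sq_nonneg _)
  have f2 : min (P.d₁ / 4) (ε * P.d₂ / 2) * (c * T ^ 2) ≤ ε * P.d₂ / 2 * (c * T ^ 2) :=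
    mul_le_mul_of_nonneg_right (min_le_right _ _) (by positivity)
  have f3 : (1 / P.d₁ + ε / P.d₂) * P.forcing x ^ 2 ≤
      (1 / P.d₁ + ε / P.d₂) * (k₀ * ((x 0 ^ 2 + x 1 ^ 2) * (1 + x 3 ^ 2))) :=
    mul_le_mul_of_nonneg_left (hforce x) (by positivity)
  linarith

/-- The cascade `s' = γ / ψ - α s`, `γ' = - a γ` has a quadratic Lyapunov function. -/
theorem exists_quadratic_decay (hP : P.Admissible) {R : ℝ} (hR : 0 < R) :
    ∃ K₁ K₂ : ℝ, 0 < K₁ ∧ 0 < K₂ ∧ ∀ x : X,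
      K₁ * (2 * x 0 * P.sDot x) + K₂ * (2 * x 1 * (-P.a * x 1)) ≤ -R * (x 0 ^ 2 + x 1 ^ 2) := by
  have hm : 0 < P.M * P.I - P.L ^ 2 := sub_pos.2 hP.inertia
  have ha := hP.a_pos
  have hα := hP.α_pos
  have hsd := P.sDot_mul_le hP
  set m := P.M * P.I - P.L ^ 2
  -- `K₁` makes the `s²` coefficient exactly `-R`; `K₂` makes the decay of `γ` pay for `R` and for
  -- the `γ²` term left over from Young's inequality.
  refine ⟨R / P.α, (R + R / P.α / (P.α * m ^ 2)) / (2 * P.a), by positivity, by positivity,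
    fun x => ?_⟩
  have f1 := mul_le_mul_of_nonneg_left (hsd x) (show 0 ≤ 2 * (R / P.α) by positivity)
  have f2 : 2 * (R / P.α) * (-(P.α / 2) * x 0 ^ 2 + 1 / (2 * P.α * m ^ 2) * x 1 ^ 2) =
      -R * x 0 ^ 2 + R / P.α / (P.α * m ^ 2) * x 1 ^ 2 := by field_simp
  have f3 : (R + R / P.α / (P.α * m ^ 2)) / (2 * P.a) * (2 * x 1 * (-P.a * x 1)) =
      -R * x 1 ^ 2 - R / P.α / (P.α * m ^ 2) * x 1 ^ 2 := by field_simp; ring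
  linarith

/-- The unperturbed system has a twice continuously differentiable Lyapunov function. -/
theorem exists_isLyapunov (hP : P.Admissible) : ∃ V, P.IsLyapunov V ∧ ContDiff ℝ 2 V := by
  have hD : 0 < P.ϱ * P.L - P.I := sub_pos.2 hP.rho_L
  have hL : 0 < P.L := mul_pos hP.m_pos hP.l_pos
  have hI : 0 < P.I := add_pos hP.J_pos (mul_pos hP.m_pos (pow_pos hP.l_pos 2))
  have hd₁ : 0 < P.d₁ := div_pos (sub_pos.2 hP.rho_κ) hD
  have hd₂ : 0 < P.d₂ := div_pos (mul_pos hL hP.g_pos) hD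
  have hd₃ : 0 < P.d₃ := div_pos hI hD
  obtain ⟨ε, δ, k', hε, hδ, hk', hdiss⟩ := P.exists_energy_dissipation hP hd₁ hd₂ hd₃
  have hp : 0 ≤ 2 * P.d₃ := by positivity
  set B := 5 + 2 * (2 * P.d₃ + 1) / P.d₂ with hB
  have hB1 : 1 ≤ B := by
    have : 0 < 2 * (2 * P.d₃ + 1) / P.d₂ := by positivity
    linarith
  -- The rate `k' * B + 1` is the cost of the forcing relative to `1 + F`, plus `1` to spare.
  obtain ⟨K₁, K₂, hK₁, hK₂, hquad⟩ := P.exists_quadratic_decay hP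
    (show 0 < k' * B + 1 by positivity)
  have hk : 0 < 1 + B / δ := by positivity
  let F : X → ℝ := fun x => weightedEnergy (2 * P.d₃) P.d₂ ε (x 2) (x 3)
  let Q : X → ℝ := fun x => K₁ * x 0 ^ 2 + K₂ * x 1 ^ 2
  let V : X → ℝ := fun x => (1 + B / δ) * (((1 + F x) ^ 2 * Real.exp (2 * Q x) - 1) / 2)
  have hVsm : ContDiff ℝ 2 V := by
    have hx := fun i => (contDiff_euclidean (n := 2)).1 (contDiff_id (𝕜 := ℝ) (E := X)) i
    have hF : ContDiff ℝ 2 F := contDiff_weightedEnergy _ _ _ (hx 2) (hx 3)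
    have h0 := hx 0
    have h1 := hx 1
    simp only [id] at h0 h1
    have hQ : ContDiff ℝ 2 Q := by unfold Q; fun_prop
    unfold V
    fun_prop
  have hFlow : ∀ x, x 3 ^ 2 / 4 + P.d₂ / (4 * (2 * P.d₃ + 1)) * x 2 ^ 2 ≤ F x := fun x =>
    quadratic_le_weightedEnergy hp hd₂.le hε (x 2) (x 3)
  have hv : 0 < P.d₂ / (4 * (2 * P.d₃ + 1)) := by positivity
  have hF0 : ∀ x, 0 ≤ F x := fun x => le_trans (by positivity) (hFlow x)
  have hQ0 : ∀ x, 0 ≤ Q x := fun x => by unfold Q; positivity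
  refine ⟨V, ?_, hVsm⟩
  refine IsLyapunov.of_quadratic_le (hVsm.of_le (by norm_num)) ?_
    (b := (1 + B / δ) * min (min K₁ K₂) (min (1 / 4) (P.d₂ / (4 * (2 * P.d₃ + 1))))) ?_ ?_ ?_
  · simp [V, F, Q, weightedEnergy_zero]
  · exact mul_pos hk (lt_min (lt_min hK₁ hK₂) (lt_min (by norm_num) hv))
  · intro x
    set b := min (min K₁ K₂) (min (1 / 4) (P.d₂ / (4 * (2 * P.d₃ + 1))))
    have hb1 : b ≤ K₁ := (min_le_left _ _).trans (min_le_left _ _)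
    have hb2 : b ≤ K₂ := (min_le_left _ _).trans (min_le_right _ _)
    have hb3 : b ≤ 1 / 4 := (min_le_right _ _).trans (min_le_left _ _)
    have hb4 : b ≤ P.d₂ / (4 * (2 * P.d₃ + 1)) := (min_le_right _ _).trans (min_le_right _ _)
    have h1 : 1 + 2 * F x + 2 * Q x ≤ (1 + F x) ^ 2 * Real.exp (2 * Q x) := by
      have f1 := Real.add_one_le_exp (2 * Q x)
      have f2 := hF0 x
      have f3 := hQ0 x
      have f4 : (1 + F x) ^ 2 * (2 * Q x + 1) ≤ (1 + F x) ^ 2 * Real.exp (2 * Q x) := by gcongr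
      nlinarith [mul_nonneg f2 f3, mul_nonneg (mul_nonneg f2 f2) f3]
    have h3 : b * ‖x‖ ^ 2 ≤ F x + Q x := by
      rw [norm_sq_eq]
      have g0 := mul_le_mul_of_nonneg_right hb1 (sq_nonneg (x 0))
      have g1 := mul_le_mul_of_nonneg_right hb2 (sq_nonneg (x 1))
      have g2 := mul_le_mul_of_nonneg_right hb4 (sq_nonneg (x 2))
      have g3 := mul_le_mul_of_nonneg_right hb3 (sq_nonneg (x 3))
      have g6 : Q x = K₁ * x 0 ^ 2 + K₂ * x 1 ^ 2 := rfl
      linarith [hFlow x]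
    rw [mul_assoc]
    exact mul_le_mul_of_nonneg_left (by linarith) hk.le
  · intro x
    -- The derivative of `V` in the direction of the field is computed along the straight line
    -- through `x`, where the one-variable formulas for `F` and `Q` apply.
    have hcomp : ∀ i : Fin 4, HasDerivAt (fun t : ℝ => (x + t • P.slowField x 0) i)
        (P.slowField x 0 i) 0 := fun i => by
      simpa using! ((hasDerivAt_id (0 : ℝ)).mul_const (P.slowField x 0 i)).const_add (x i)
    have hFd := hasDerivAt_weightedEnergy (d := P.d₂) ε (show 2 * P.d₃ + 1 ≠ 0 by positivity)
      (hcomp 2) (hcomp 3)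
    have hQd := ((((hcomp 0).pow 2).const_mul K₁).add (((hcomp 1).pow 2).const_mul K₂))
    have hVd : HasDerivAt (fun t : ℝ => V (x + t • P.slowField x 0)) _ 0 :=
      (((((hFd.const_add 1).pow 2).mul ((hQd.const_mul 2).exp)).sub_const 1).div_const 2).const_mul
        (1 + B / δ)
    have hline : fderiv ℝ V x (P.slowField x 0) = _ :=
      (((hVsm.differentiable two_ne_zero) x).hasFDerivAt.hasLineDerivAt _).lineDeriv.symm.trans
        hVd.deriv
    have hv0 : P.slowField x 0 0 = P.sDot x := rfl
    have hv1 : P.slowField x 0 1 = -P.a * x 1 := P.gammaDot_zero_right x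
    have hv2 : P.slowField x 0 2 = x 3 := rfl
    have hv3 : P.slowField x 0 3 = _ := P.omegaDDot_zero_right x
    rw [hline]
    simp only [Pi.pow_apply, Pi.add_apply, zero_smul, add_zero, hv0, hv1, hv2, hv3]
    have hc := Real.one_le_cosh (x 2)
    have hq := Real.one_le_rpow hc hp
    have hT1 : (Real.sinh (x 2) / Real.cosh (x 2)) ^ 2 ≤ 1 := by
      rw [tanh_sq_eq]
      have : 0 < 1 / Real.cosh (x 2) ^ 2 := by positivity
      linarith
    have hS : Real.sinh (x 2) = Real.cosh (x 2) * (Real.sinh (x 2) / Real.cosh (x 2)) := by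
      rw [mul_div_cancel₀ _ (Real.cosh_pos _).ne']
    have hΩ := sq_le_sinh_sq (x 2)
    rw [hS] at hΩ
    have hb := weight_le_weightedEnergy hp hd₂ hε (x 2) (x 3)
    have hFd' := mul_le_mul_of_nonneg_left (hdiss x _ _ hc hT1) (zero_le_one.trans hq)
    have hfin := lyapunov_decay_aux hδ hB1 hk' (Φ := 1 + F x) (by linarith [hF0 x]) hq hc
      (Real.one_le_exp (show 0 ≤ 2 * Q x by linarith [hQ0 x])) hb.1 hb.2 hΩ
      (show 0 ≤ x 0 ^ 2 + x 1 ^ 2 by positivity) hFd' (hquad x)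
    have hFx : weightedEnergy (2 * P.d₃) P.d₂ ε (x 2) (x 3) = F x := rfl
    have hQx : K₁ * x 0 ^ 2 + K₂ * x 1 ^ 2 = Q x := rfl
    rw [norm_sq_eq, hFx, hQx]
    refine le_of_eq_of_le ?_ (hfin.trans (le_of_eq (by ring)))
    rw [← hS]
    generalize Real.exp (2 * Q x) = e
    generalize F x = Φ
    generalize Real.cosh (x 2) ^ (2 * P.d₃) = q
    generalize Real.sinh (x 2) / Real.cosh (x 2) = T
    generalize 1 + B / δ = k
    push_cast
    ring

end Params

end CartPendulum

end

theorem mainTheorem1 (P : CartPendulum.Params) (hP : P.Admissible) :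
    (∃ V : CartPendulum.X → ℝ, P.IsLyapunov V) ∧
    ∀ (V : CartPendulum.X → ℝ), P.IsLyapunov V → ∀ ρ : ℝ, 0 < ρ →
      ∃ (C : ℝ → ℝ) (μ₀ : ℝ), 0 < μ₀ ∧
        (∀ μ₁ : ℝ, 0 < μ₁ → μ₁ ≤ μ₀ → 0 < C μ₁ ∧
          ∀ μ : ℝ, 0 < μ → μ ≤ μ₁ →
            CartPendulum.IsAttractionDomain (P.field μ)
              {y | CartPendulum.composite V ρ y ≤ C μ₁}) ∧
        Tendsto C (𝓝[>] 0) atTop ∧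
        (∀ K : Set (CartPendulum.X × CartPendulum.Z), IsCompact K →
          ∀ᶠ μ₁ in 𝓝[>] (0 : ℝ), K ⊆ {y | CartPendulum.composite V ρ y ≤ C μ₁}) := by
  obtain ⟨V₁, hV₁, hV₁2⟩ := P.exists_isLyapunov hP
  exact ⟨⟨V₁, hV₁⟩, fun V hV ρ hρ =>
    CartPendulum.Params.exists_attractionDomain hP hV₁ hV₁2 hV hρ⟩
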